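/- Let $\mathbb T^2=(\mathbb R/2\pi\mathbb Z)^2$, $b\in\mathbb R$ and $\varepsilon>0$. Write $(\nabla u)_{ij}=\partial_j u_i$, $D(u)=\tfrac12(\nabla u+\nabla u^\top)$, $W(u)=\tfrac12(\nabla u-\nabla u^\top)$, $(\nabla\cdot\tau)_i=\sum_j\partial_j\tau_{ij}$ and $Q(\tau,\nabla u)=\tau W(u)-W(u)\tau+b\,(\tau D(u)+D(u)\tau)$. Consider the inviscid Euler–Oldroyd-B system for $u:[0,T]\times\mathbb T^2\to\mathbb R^2$, $\tau:[0,T]\times\mathbb T^2\to\mathbb R^{2\times2}$, $$\partial_t u+u\cdot\nabla u+\nabla p=\nabla\cdot\tau,\qquad \partial_t\tau+u\cdot\nabla\tau+Q(\tau,\nabla u)=\tfrac1{\varepsilon^2}\,(D(u)-\tau),\qquad \nabla\cdot u=0,$$ with $\int_{\mathbb T^2}u\,dx=0$. For real $s\ge 3$ let $X^s$ be the set of all $(u,\tau)\in H^s(\mathbb T^2)$ with $\nabla\cdot u=0$ and $\int u=0$. The system is called well-posed in $H^s$ at a datum $U_0\in X^s$, in the sense of Hadamard, if there are $T>0$ and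 $R>0$ such that (existence and uniqueness) every $U_1\in X^s$ with $\|U_1-U_0\|_{H^s}<R$ is the initial datum of exactly one solution $U=(u,\tau)$ on $[0,T]$ in the solution class, and (continuous dependence) the map $U_1\mapsto U$ is continuous at $U_0$ from $H^s$ to $L^\infty(0,T;H^s)$. It is well-posed in $H^s$ if it is well-posed at every $U_0\in X^s$, and ill-posed in $H^s$ otherwise. The solution class is either $L^\infty(0,T;H^s)$ or $C([0,T];H^s)$, and the stress tensor is either an arbitrary or a symmetric $2\times2$ matrix; the result holds for each of these four choices. **Theorem.** For every fixed $b\in\mathbb R$ and $\varepsilon>0$: 1. (Nonlinear ill-posedness.) The system is ill-posed in $H^s$, in the sense of Hadamard, for every real $s\ge3$. 2. (Instability of isotropic stress.) Let $a\in\mathbb R$ with $ab>\frac1{2\varepsilon^2}$ and $\tau_a=a\,\mathrm{Id}$ (for example $\varepsilon=1$, $b=-1$, $a=-2$). Then for every real $s\ge3$ the system is not well-posed in $H^s$ at the datum $(0,\tau_a)$. Moreover, the linearized system $$\partial_t u+\nabla p=\nabla\cdot\eta,\qquad \partial_t\eta+Q(\tau_a,\nabla u)=\tfrac1{\varepsilon^2}\,(D(u)-\eta-\tau_a),\qquad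 \nabla\cdot u=0$$ about $(0,\tau_a)$ (with $\eta=\tau-\tau_a$) has, for every integer $k\ne0$ and suitable constants $P\in\mathbb C$, $\Sigma\in\mathbb C^{2\times2}$, the complex solution $$u=(0,1)^\top e^{\lambda_+(k)t}e^{ikx_1},\qquad p=P\,e^{\lambda_+(k)t}e^{ikx_1},\qquad \eta=(e^{-t/\varepsilon^2}-1)\,\tau_a+e^{\lambda_+(k)t}\,\Sigma\, e^{ikx_1},$$ where $$\lambda_+(k)=\tfrac12\Bigl(-\tfrac1{\varepsilon^2}+\sqrt{\tfrac1{\varepsilon^4}+4\bigl(ab-\tfrac1{2\varepsilon^2}\bigr)k^2}\Bigr)\in\mathbb R,\qquad \lim_{|k|\to\infty}\frac{\lambda_+(k)}{|k|}=\sqrt{ab-\tfrac1{2\varepsilon^2}}>0 .$$ -/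

import Mathlib

open scoped ENNReal

noncomputable section

namespace EulerOldroydB

/-- Points of the plane.  The torus `𝕋² = (ℝ / 2πℤ)²` is handled through functions on the plane that
are `2π`-periodic in each coordinate. -/
abbrev Point := Fin 2 → ℝ

section Calculus

variable {𝕜 : Type*} [RCLike 𝕜]

/-- The partial derivative `∂_j f` of a scalar function of the space variable. -/
def pderiv (j : Fin 2) (f : Point → 𝕜) (x : Point) : 𝕜 :=
  fderiv ℝ f x (Pi.single j 1)

/-- The velocity gradient, `(∇u)_{ij} = ∂_j u_i`. -/
def grad (u : Point → Fin 2 → 𝕜) (x : Point) : Matrix (Fin 2) (Fin 2) 𝕜 :=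
  Matrix.of fun i j => pderiv j (fun y => u y i) x

/-- The divergence of a vector field. -/
def divVec (u : Point → Fin 2 → 𝕜) (x : Point) : 𝕜 :=
  ∑ j, pderiv j (fun y => u y j) x

/-- The divergence of a tensor field, `(∇ · τ)_i = ∑_j ∂_j τ_{ij}`. -/
def divTensor (τ : Point → Matrix (Fin 2) (Fin 2) 𝕜) (x : Point) (i : Fin 2) : 𝕜 :=
  ∑ j, pderiv j (fun y => τ y i j) x

/-- The symmetric part of a matrix; `D(u) = symPart (∇u)`. -/
def symPart (G : Matrix (Fin 2) (Fin 2) 𝕜) : Matrix (Fin 2) (Fin 2) 𝕜 :=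
  (1 / 2 : ℝ) • (G + G.transpose)

/-- The skew part of a matrix; `W(u) = skewPart (∇u)`. -/
def skewPart (G : Matrix (Fin 2) (Fin 2) 𝕜) : Matrix (Fin 2) (Fin 2) 𝕜 :=
  (1 / 2 : ℝ) • (G - G.transpose)

/-- The rotation correction `Q(τ, G) = τ W - W τ + b (τ D + D τ)`, where `D` and `W` are the
symmetric and the skew part of the velocity gradient `G`. -/
def rotationQ (b : ℝ) (τ G : Matrix (Fin 2) (Fin 2) 𝕜) : Matrix (Fin 2) (Fin 2) 𝕜 :=
  τ * skewPart G - skewPart G * τ + b • (τ * symPart G + symPart G * τ)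

end Calculus

/-- `f` is `2π`-periodic in each coordinate, i.e. it is a function on the torus. -/
def IsPeriodic (f : Point → ℝ) : Prop :=
  ∀ (x : Point) (j : Fin 2), f (x + Pi.single j (2 * Real.pi)) = f x

/-- The fundamental cell `[0, 2π]²`. -/
def cell : Set Point := Set.Icc (fun _ => 0) (fun _ => 2 * Real.pi)

/-- The Fourier coefficient `(2π)⁻² ∫_{[0,2π]²} f(x) e^{-i n·x} dx`. -/
def fourierCoefficient (f : Point → ℝ) (n : Fin 2 → ℤ) : ℂ :=
  (((2 * Real.pi) ^ 2)⁻¹ : ℝ) •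
    ∫ x in cell, (f x : ℂ) * Complex.exp (-(Complex.I * ∑ j, (n j : ℂ) * (x j : ℂ)))

/-- The square of the `H^s(𝕋²)` norm, `∑_n (1 + |n|²)^s |f̂(n)|²`, with values in `[0, ∞]`. -/
def sobolevSq (s : ℝ) (f : Point → ℝ) : ℝ≥0∞ :=
  ∑' n : Fin 2 → ℤ,
    ENNReal.ofReal ((1 + ∑ j, (n j : ℝ) ^ 2) ^ s * ‖fourierCoefficient f n‖ ^ 2)

/-- A state of the fluid: velocity field and stress field. -/
abbrev State := (Point → Fin 2 → ℝ) × (Point → Matrix (Fin 2) (Fin 2) ℝ)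

/-- The norm `‖(u, τ)‖_{H^s}`, with values in `[0, ∞]`. -/
def sobolevNorm (s : ℝ) (U : State) : ℝ≥0∞ :=
  ((∑ i, sobolevSq s (fun x => U.1 x i)) + ∑ i, ∑ j, sobolevSq s (fun x => U.2 x i j)) ^
    (1 / 2 : ℝ)

/-- Where the stress takes its values: in all `2 × 2` matrices or in the symmetric ones. -/
inductive StressSpace where
  | general : StressSpace
  | symmetric : StressSpace

/-- The matrices that belong to a stress space. -/
def StressSpace.tensors : StressSpace → Set (Matrix (Fin 2) (Fin 2) ℝ)
  | .general => Set.univ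
  | .symmetric => {M | M.IsSymm}

/-- The phase space: `(u, τ) ∈ H^s(𝕋²)` with `∇ · u = 0` and `∫ u = 0`.  It is used for `s ≥ 3`
only, where each class in `H^s` has exactly one continuous representative, and this representative
is continuously differentiable. -/
structure InPhaseSpace (K : StressSpace) (s : ℝ) (U : State) : Prop where
  continuous_velocity : ∀ i, Continuous fun x => U.1 x i
  continuous_stress : ∀ i j, Continuous fun x => U.2 x i j
  periodic_velocity : ∀ i, IsPeriodic fun x => U.1 x i
  periodic_stress : ∀ i j, IsPeriodic fun x => U.2 x i j
  finite_norm : sobolevNorm s U < ∞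
  div_free : ∀ x, divVec U.1 x = 0
  mean_zero : ∀ i, ∫ x in cell, U.1 x i = 0
  stress_mem : ∀ x, U.2 x ∈ K.tensors

/-- `U = (u, τ)` solves, on `[0, T] × 𝕋²` and with some periodic pressure `p`,
`∂_t u + u·∇u + ∇p = ∇·τ`, `∂_t τ + u·∇τ + Q(τ, ∇u) = ε⁻² (D(u) - τ)`, `∇·u = 0`.
Fields that are bounded in `H^s`, `s ≥ 3`, and solve the system in the sense of distributions have
the joint `C¹` regularity that is asked for here.  (`∇·u = 0` is part of `InPhaseSpace`; time
derivatives at the end points of `[0, T]` are one-sided.) -/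
structure IsSolution (b ε : ℝ) (K : StressSpace) (s T : ℝ) (U : ℝ → State) : Prop where
  inPhaseSpace : ∀ t ∈ Set.Icc 0 T, InPhaseSpace K s (U t)
  contDiff_velocity : ∀ i,
    ContDiffOn ℝ 1 (fun z : ℝ × Point => (U z.1).1 z.2 i) (Set.Icc 0 T ×ˢ Set.univ)
  contDiff_stress : ∀ i j,
    ContDiffOn ℝ 1 (fun z : ℝ × Point => (U z.1).2 z.2 i j) (Set.Icc 0 T ×ˢ Set.univ)
  momentum : ∃ p : ℝ → Point → ℝ,
    (∀ t ∈ Set.Icc 0 T, ContDiff ℝ 1 (p t) ∧ IsPeriodic (p t)) ∧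
    ∀ t ∈ Set.Icc 0 T, ∀ x i,
      derivWithin (fun r => (U r).1 x i) (Set.Icc 0 T) t
        + ∑ k, (U t).1 x k * pderiv k (fun y => (U t).1 y i) x + pderiv i (p t) x
        = divTensor (U t).2 x i
  stress : ∀ t ∈ Set.Icc 0 T, ∀ x i j,
    derivWithin (fun r => (U r).2 x i j) (Set.Icc 0 T) t
      + ∑ k, (U t).1 x k * pderiv k (fun y => (U t).2 y i j) x
      + rotationQ b ((U t).2 x) (grad (U t).1 x) i j
      = 1 / ε ^ 2 * (symPart (grad (U t).1 x) i j - (U t).2 x i j)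

/-- The two usual classes of `H^s` solutions: bounded in time, or continuous in time. -/
inductive TimeClass where
  | bounded : TimeClass
  | continuous : TimeClass

/-- `U ∈ L^∞(0, T; H^s)`, respectively `U ∈ C([0, T]; H^s)`. -/
def TimeClass.Mem (s T : ℝ) (U : ℝ → State) : TimeClass → Prop
  | .bounded => ∃ M : ℝ≥0∞, M < ∞ ∧ ∀ t ∈ Set.Icc 0 T, sobolevNorm s (U t) ≤ M
  | .continuous => ∀ t₀ ∈ Set.Icc 0 T,
      Filter.Tendsto (fun t => sobolevNorm s (U t - U t₀)) (nhdsWithin t₀ (Set.Icc 0 T)) (nhds 0)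

/-- `U` is an `H^s` solution on `[0, T]`, of time class `C`, with initial datum `U₀`. -/
def SolvesFrom (b ε : ℝ) (K : StressSpace) (C : TimeClass) (s T : ℝ) (U₀ : State)
    (U : ℝ → State) : Prop :=
  IsSolution b ε K s T U ∧ C.Mem s T U ∧ U 0 = U₀

/-- Local well-posedness in `H^s`, in the sense of Hadamard, at the datum `U₀`: on some common
interval `[0, T]`, all data in some `H^s` ball around `U₀` have exactly one solution, and the
solution, measured in `L^∞(0, T; H^s)`, depends continuously on the datum at `U₀`. -/
def WellPosedAt (b ε : ℝ) (K : StressSpace) (C : TimeClass) (s : ℝ) (U₀ : State) : Prop :=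
  ∃ T : ℝ, 0 < T ∧ ∃ R : ℝ≥0∞, 0 < R ∧
    -- existence
    (∀ U₁, InPhaseSpace K s U₁ → sobolevNorm s (U₁ - U₀) < R →
      ∃ U, SolvesFrom b ε K C s T U₁ U) ∧
    -- uniqueness
    (∀ U₁, InPhaseSpace K s U₁ → sobolevNorm s (U₁ - U₀) < R →
      ∀ U V, SolvesFrom b ε K C s T U₁ U → SolvesFrom b ε K C s T U₁ V →
        ∀ t ∈ Set.Icc 0 T, U t = V t) ∧
    -- continuous dependence
    (∀ η : ℝ≥0∞, 0 < η → ∃ δ : ℝ≥0∞, 0 < δ ∧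
      ∀ U₁, InPhaseSpace K s U₁ → sobolevNorm s (U₁ - U₀) < δ →
        ∀ U V, SolvesFrom b ε K C s T U₀ U → SolvesFrom b ε K C s T U₁ V →
          ∀ t ∈ Set.Icc 0 T, sobolevNorm s (V t - U t) ≤ η)

/-- The system is (locally) well-posed in `H^s` in the sense of Hadamard. -/
def HadamardWellPosed (b ε : ℝ) (K : StressSpace) (C : TimeClass) (s : ℝ) : Prop :=
  ∀ U₀, InPhaseSpace K s U₀ → WellPosedAt b ε K C s U₀

/-- The state at rest with constant isotropic stress `τ_a = a Id`. -/
def isotropicState (a : ℝ) : State := (fun _ _ => 0, fun _ => a • 1)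

/-- `(u, p, η)` solves the linearization, around velocity `0` and stress `τ_a = a Id`, of the system
written for `(u, η)`, `η = τ - τ_a`:
`∂_t u + ∇p = ∇·η`, `∂_t η + Q(τ_a, ∇u) = ε⁻² (D(u) - η - τ_a)`, `∇·u = 0`.
The fields are complex-valued, so that Fourier modes are admitted. -/
structure SolvesLinearized (b ε a : ℝ) (u : ℝ → Point → Fin 2 → ℂ) (p : ℝ → Point → ℂ)
    (η : ℝ → Point → Matrix (Fin 2) (Fin 2) ℂ) : Prop where
  smooth_velocity : ∀ i, ContDiff ℝ 1 fun z : ℝ × Point => u z.1 z.2 i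
  smooth_pressure : ∀ t, ContDiff ℝ 1 (p t)
  smooth_stress : ∀ i j, ContDiff ℝ 1 fun z : ℝ × Point => η z.1 z.2 i j
  momentum : ∀ t x i,
    deriv (fun r => u r x i) t + pderiv i (p t) x = divTensor (η t) x i
  stress : ∀ t x i j,
    deriv (fun r => η r x i j) t + rotationQ b (a • (1 : Matrix (Fin 2) (Fin 2) ℂ)) (grad (u t) x) i j
      = ((1 / ε ^ 2 : ℝ) : ℂ) *
        (symPart (grad (u t) x) i j - η t x i j - (a • (1 : Matrix (Fin 2) (Fin 2) ℂ)) i j)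
  div_free : ∀ t x, divVec (u t) x = 0

/-- The exponent `λ₊(k)`, the larger root of `λ² + ε⁻² λ - (a b - 1 / (2 ε²)) k² = 0`. -/
def lambdaPlus (b ε a : ℝ) (k : ℤ) : ℝ :=
  (-(1 / ε ^ 2) + Real.sqrt ((1 / ε ^ 2) ^ 2 + 4 * (a * b - 1 / (2 * ε ^ 2)) * (k : ℝ) ^ 2)) / 2

/-- The factor `e^{λ t} e^{i k x₁}` of a Fourier mode. -/
def modeFactor (lam : ℝ) (k : ℤ) (t : ℝ) (x : Point) : ℂ :=
  Complex.exp ((lam * t : ℝ) : ℂ) * Complex.exp (Complex.I * (k : ℂ) * (x 0 : ℂ))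

end EulerOldroydB

end

/-! Write γ = ε⁻². A flow u = (0, v(t, x₁)) whose stress depends on (t, x₁) only obeys v_t = σ_x and
σ_t = -γσ + (γ - A)/2 · v_x, where σ = τ₂₁ and A = τ₂₂ - τ₁₁ + b(τ₁₁ + τ₂₂); A itself relaxes at the
rate γ up to the source (1 - b²)(τ₁₂ + τ₂₁)v_x (`IsSolution.shearFlow`). Where A > γ the system for
(v, σ) is elliptic in (t, x₁) instead of hyperbolic, and frequency N grows like exp(cNt): a Hadamard
instability. At the stress diag(a₁, a₂) the value of A is a₂ - a₁ + b(a₁ + a₂). It exceeds γ for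
some trace-free stress whatever b is, and for a Id exactly when ab > 1/(2ε²).

The nonlinear statement is by contradiction. Suppose that the system is well-posed at such a
diagonal state, whose solution `relaxingState` merely decays. Add a shear mode of frequency N and
amplitude dN⁻ˢ, which is small in H^s uniformly in N. Existence gives a solution V, and continuous
dependence keeps it in the unit H^s ball around the background. Uniqueness gives symmetry: the
equations commute with translations (`SolvesFrom.translate`), so V inherits from its datum the
invariance in x₂, which makes it a shear flow, and the period 2π/N in x₁. This period leaves only
frequencies divisible by N, so the H^s bound improves to |v_x| ≲ N^(1-s)
(`abs_deriv_le_of_weighted_sq_le`). Hence A stays within O(N^(1-s)) of its relaxing value, and the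
error in the equation of mode N is quadratic in the bound for v_x.

`ShearFlow.exp_growth` follows the product of the cosine integral of v and the sine integral of σ at
frequency N, which grows at a rate μN up to that error. The product starts at size d²N^(-2s), and
the H^s bound caps it by a multiple of N^(-2s). The powers of N cancel and leave exp(μNT')(d² -
O(1/N)) ≤ 4 (`exp_growth_of_solution`), which fails for large N. The linearized statement is a
direct computation with the dispersion relation λ² + γλ = (ab - γ/2)k². -/

namespace EulerOldroydB

open MeasureTheory

/-! ### Integrals over the fundamental cell -/

section Cell

variable {E : Type*} [NormedAddCommGroup E] [NormedSpace ℝ E]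

theorem two_pi_nonneg : 0 ≤ 2 * Real.pi := Real.two_pi_pos.le

theorem setIntegral_cell {F : Point → E} (hF : Continuous F) :
    ∫ x in cell, F x =
      ∫ x in (0 : ℝ)..2 * Real.pi, ∫ y in (0 : ℝ)..2 * Real.pi, F ![x, y] := by
  have hG : Continuous fun z : ℝ × ℝ => F ![z.1, z.2] := by
    refine hF.comp (continuous_pi fun i => ?_)
    fin_cases i
    · exact continuous_fst
    · exact continuous_snd
  have hpre : cell = MeasurableEquiv.finTwoArrow ⁻¹'
      (Set.Icc (0 : ℝ) (2 * Real.pi) ×ˢ Set.Icc (0 : ℝ) (2 * Real.pi)) := by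
    ext x
    simp only [cell, Set.mem_Icc, Pi.le_def, Fin.forall_fin_two, Set.mem_preimage,
      MeasurableEquiv.finTwoArrow, Set.mem_prod]
    constructor
    · rintro ⟨⟨h1, h2⟩, h3, h4⟩
      exact ⟨⟨h1, h3⟩, h2, h4⟩
    · rintro ⟨⟨h1, h3⟩, h2, h4⟩
      exact ⟨⟨h1, h2⟩, h3, h4⟩
  have hpt : ∀ x : Point, F x = (fun z : ℝ × ℝ => F ![z.1, z.2])
      (MeasurableEquiv.finTwoArrow x) := by
    intro x
    congr 1
    ext i
    fin_cases i <;> rfl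
  rw [hpre]
  refine (integral_congr_ae (Filter.Eventually.of_forall hpt)).trans ?_
  refine ((volume_preserving_finTwoArrow ℝ).setIntegral_preimage_emb
    MeasurableEquiv.finTwoArrow.measurableEmbedding (fun z => F ![z.1, z.2]) _).trans ?_
  rw [Measure.volume_eq_prod,
    setIntegral_prod _ (hG.continuousOn.integrableOn_compact (isCompact_Icc.prod isCompact_Icc))]
  rw [intervalIntegral.integral_of_le two_pi_nonneg, integral_Icc_eq_integral_Ioc]
  refine integral_congr_ae (Filter.Eventually.of_forall fun x => ?_)
  simp only
  rw [intervalIntegral.integral_of_le two_pi_nonneg, integral_Icc_eq_integral_Ioc]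

theorem setIntegral_cell_add {F : Point → E} (hF : Continuous F)
    (hp : ∀ x j, F (x + Pi.single j (2 * Real.pi)) = F x) (h : Point) :
    ∫ x in cell, F (x + h) = ∫ x in cell, F x := by
  rw [setIntegral_cell hF, setIntegral_cell (F := fun x => F (x + h)) (by fun_prop)]
  have hshift : ∀ x y : ℝ, (![x, y] : Point) + h = ![x + h 0, y + h 1] := by
    intro x y
    ext i
    fin_cases i <;> simp
  have hinner : ∀ x : ℝ, ∫ y in (0 : ℝ)..2 * Real.pi, F ![x, y + h 1] =
      ∫ y in (0 : ℝ)..2 * Real.pi, F ![x, y] := by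
    intro x
    have hper : Function.Periodic (fun y : ℝ => F ![x, y]) (2 * Real.pi) := by
      intro y
      have := hp ![x, y] 1
      simp only
      rw [← this]
      congr 1
      ext i
      fin_cases i <;> simp
    rw [intervalIntegral.integral_comp_add_right (fun y => F ![x, y])]
    have := hper.intervalIntegral_add_eq (h 1) 0
    simpa [add_comm] using this
  simp_rw [hshift, hinner]
  have hper : Function.Periodic
      (fun x : ℝ => ∫ y in (0 : ℝ)..2 * Real.pi, F ![x, y]) (2 * Real.pi) := by
    intro x
    refine intervalIntegral.integral_congr fun y _ => ?_
    have := hp ![x, y] 0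
    rw [← this]
    congr 1
    ext i
    fin_cases i <;> simp
  rw [intervalIntegral.integral_comp_add_right
    (fun x => ∫ y in (0 : ℝ)..2 * Real.pi, F ![x, y])]
  have := hper.intervalIntegral_add_eq (h 0) 0
  simpa [add_comm] using this

end Cell

/-! ### Fourier coefficients and Sobolev norms under translations -/

theorem continuous_fourierCoefficient_integrand {f : Point → ℝ} (hf : Continuous f)
    (n : Fin 2 → ℤ) : Continuous fun x : Point =>
      (f x : ℂ) * Complex.exp (-(Complex.I * ∑ j, (n j : ℂ) * (x j : ℂ))) := by
  fun_prop

theorem fourierCoefficient_translate {f : Point → ℝ} (hf : Continuous f) (hp : IsPeriodic f)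
    (h : Point) (n : Fin 2 → ℤ) :
    fourierCoefficient (fun x => f (x + h)) n =
      Complex.exp (Complex.I * ∑ j, (n j : ℂ) * (h j : ℂ)) * fourierCoefficient f n := by
  have key := setIntegral_cell_add (continuous_fourierCoefficient_integrand hf n) (by
    intro x j
    rw [hp x j]
    congr 1
    have : (-(Complex.I * ∑ i, (n i : ℂ) * (((x + Pi.single j (2 * Real.pi) : Point) i : ℝ) : ℂ))) =
        -(Complex.I * ∑ i, (n i : ℂ) * (x i : ℂ)) + ((-n j : ℤ) : ℂ) * (2 * Real.pi * Complex.I) := by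
      fin_cases j <;> simp [Fin.sum_univ_two] <;> ring
    rw [this, Complex.exp_periodic.int_mul]) h
  unfold fourierCoefficient
  rw [← key, mul_smul_comm, ← integral_const_mul]
  congr 1
  refine integral_congr_ae (Filter.Eventually.of_forall fun x => ?_)
  simp only
  rw [mul_left_comm, ← Complex.exp_add]
  congr 2
  simp [Fin.sum_univ_two]
  ring

theorem norm_exp_I_mul_sum (n : Fin 2 → ℤ) (h : Point) :
    ‖Complex.exp (Complex.I * ∑ j, (n j : ℂ) * (h j : ℂ))‖ = 1 := by
  have : (Complex.I * ∑ j, (n j : ℂ) * (h j : ℂ)) =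
      ((∑ j, (n j : ℝ) * h j : ℝ) : ℂ) * Complex.I := by
    push_cast
    ring
  rw [this, Complex.norm_exp_ofReal_mul_I]

/-- A translation multiplies each Fourier coefficient by a phase of modulus one. This is what admits
translates of a solution as competitors in the uniqueness statement. -/
theorem sobolevSq_translate {f : Point → ℝ} (hf : Continuous f) (hp : IsPeriodic f)
    (h : Point) (s : ℝ) : sobolevSq s (fun x => f (x + h)) = sobolevSq s f := by
  unfold sobolevSq
  refine tsum_congr fun n => ?_
  rw [fourierCoefficient_translate hf hp, norm_mul, norm_exp_I_mul_sum, one_mul]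

/-! ### Functions of the first variable -/

theorem fourierCoefficient_comp_fst {g : ℝ → ℝ} (hg : Continuous g) (n : Fin 2 → ℤ) :
    fourierCoefficient (fun x => g (x 0)) n =
      (((2 * Real.pi) ^ 2)⁻¹ : ℝ) •
        ((∫ x in (0 : ℝ)..2 * Real.pi, (g x : ℂ) * Complex.exp (-(Complex.I * n 0 * x))) *
          ∫ y in (0 : ℝ)..2 * Real.pi, Complex.exp (-(Complex.I * n 1) * y)) := by
  unfold fourierCoefficient
  rw [setIntegral_cell (continuous_fourierCoefficient_integrand (f := fun x => g (x 0))
    (hg.comp (continuous_apply 0)) n)]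
  congr 1
  rw [← intervalIntegral.integral_mul_const]
  refine intervalIntegral.integral_congr fun x _ => ?_
  rw [← intervalIntegral.integral_const_mul]
  refine intervalIntegral.integral_congr fun y _ => ?_
  simp only [Fin.sum_univ_two, Matrix.cons_val_zero, Matrix.cons_val_one]
  rw [mul_assoc, ← Complex.exp_add]
  congr 2
  ring

theorem integral_exp_int_mul (m : ℤ) (hm : m ≠ 0) :
    ∫ y in (0 : ℝ)..2 * Real.pi, Complex.exp (-(Complex.I * m) * y) = 0 := by
  rw [integral_exp_mul_complex (by simp [hm])]
  have : (-(Complex.I * m) * ((2 * Real.pi : ℝ) : ℂ)) = ((-m : ℤ) : ℂ) * (2 * Real.pi * Complex.I) := by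
    push_cast; ring
  rw [this, Complex.exp_int_mul_two_pi_mul_I]
  simp

theorem fourierCoefficient_comp_fst_of_ne {g : ℝ → ℝ} (hg : Continuous g) {n : Fin 2 → ℤ}
    (hn : n 1 ≠ 0) : fourierCoefficient (fun x => g (x 0)) n = 0 := by
  rw [fourierCoefficient_comp_fst hg, integral_exp_int_mul _ hn, mul_zero, smul_zero]

theorem fourierCoefficient_comp_fst_mode {g : ℝ → ℝ} (hg : Continuous g) (k : ℤ) :
    fourierCoefficient (fun x => g (x 0)) ![k, 0] =
      ((2 * Real.pi)⁻¹ : ℝ) •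
        ∫ x in (0 : ℝ)..2 * Real.pi, (g x : ℂ) * Complex.exp (-(Complex.I * k * x)) := by
  rw [fourierCoefficient_comp_fst hg]
  simp
  field_simp [Real.pi_ne_zero]

/-! ### Fourier coefficients of periodic functions on the line -/

/-- The Fourier coefficient `(2π)⁻¹ ∫_0^{2π} f(x) e^{-ikx} dx`. -/
noncomputable def circleCoeff (f : ℝ → ℝ) (k : ℤ) : ℂ :=
  ((2 * Real.pi)⁻¹ : ℝ) •
    ∫ x in (0 : ℝ)..2 * Real.pi, (f x : ℂ) * Complex.exp (-(Complex.I * k * x))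

/-- The Fourier series is taken on the circle of length 2π/N, whose j-th coefficient is the
coefficient of frequency jN on the circle of length 2π. Thus only multiples of N have to be
controlled. -/
theorem abs_le_of_norm_circleCoeff_le {f : ℝ → ℝ} (hf : Continuous f) {N : ℕ} (hN : 0 < N)
    (hp : Function.Periodic f (2 * Real.pi / N)) {m : ℤ → ℝ} {B : ℝ} (hm : HasSum m B)
    (h : ∀ j : ℤ, ‖circleCoeff f (j * N)‖ ≤ m j) (x : ℝ) : |f x| ≤ B := by
  have hN' : (0 : ℝ) < N := Nat.cast_pos.2 hN
  have hP : 0 < 2 * Real.pi / N := div_pos Real.two_pi_pos hN'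
  have : Fact (0 < 2 * Real.pi / N) := ⟨hP⟩
  have hpc : Function.Periodic (fun x => (f x : ℂ)) (2 * Real.pi / N) := fun x => by
    simp only; rw [hp x]
  let g : C(AddCircle (2 * Real.pi / N), ℂ) :=
    ⟨hpc.lift, Continuous.quotient_lift (Complex.continuous_ofReal.comp hf) _⟩
  have hg : ∀ y : ℝ, g (y : AddCircle (2 * Real.pi / N)) = f y := fun y => hpc.lift_coe y
  have hcoeff : ∀ j : ℤ, fourierCoeff g j = circleCoeff f (j * N) := by
    intro j
    have hh : Function.Periodic
        (fun x : ℝ => (f x : ℂ) * Complex.exp (-(Complex.I * ((j * N : ℤ) : ℂ) * x)))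
        (2 * Real.pi / N) := by
      intro x
      simp only
      rw [hp x]
      congr 1
      have hNc : (N : ℂ) ≠ 0 := Nat.cast_ne_zero.2 hN.ne'
      have : (-(Complex.I * ((j * N : ℤ) : ℂ) * ((x + 2 * Real.pi / N : ℝ) : ℂ))) =
          -(Complex.I * ((j * N : ℤ) : ℂ) * x) + ((-j : ℤ) : ℂ) * (2 * Real.pi * Complex.I) := by
        push_cast
        field_simp
        ring
      rw [this, Complex.exp_periodic.int_mul]
    -- [0, 2π] consists of N periods, and the integrand at frequency jN has period 2π/N as well.
    have hsum := hh.intervalIntegral_add_zsmul_eq (N : ℤ) 0 (fun t₁ t₂ =>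
      Continuous.intervalIntegrable (by fun_prop) _ _)
    have hend : (0 : ℝ) + (N : ℤ) • (2 * Real.pi / N) = 2 * Real.pi := by
      simp
      field_simp
    rw [hend] at hsum
    unfold circleCoeff
    rw [hsum, fourierCoeff_eq_intervalIntegral g j 0]
    have hint : ∀ y : ℝ, fourier (-j) (y : AddCircle (2 * Real.pi / N)) • g y =
        (f y : ℂ) * Complex.exp (-(Complex.I * ((j * N : ℤ) : ℂ) * y)) := by
      intro y
      rw [hg, smul_eq_mul, mul_comm, fourier_coe_apply]
      congr 2
      have hNc : (N : ℂ) ≠ 0 := Nat.cast_ne_zero.2 hN.ne'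
      have hpi : (Real.pi : ℂ) ≠ 0 := Complex.ofReal_ne_zero.2 Real.pi_ne_zero
      push_cast
      field_simp
    simp_rw [hint]
    rw [natCast_zsmul, ← Nat.cast_smul_eq_nsmul ℝ, smul_smul]
    congr 1
    field_simp
  have hsummable : Summable (fourierCoeff g) :=
    Summable.of_norm_bounded hm.summable fun j => by rw [hcoeff]; exact h j
  have hs := has_pointwise_sum_fourier_series_of_summable hsummable
    (x : AddCircle (2 * Real.pi / N))
  have := hs.norm_le_of_bounded hm fun j => by
    rw [hcoeff, norm_smul, fourier_apply, Circle.norm_coe, mul_one]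
    exact h j
  rwa [hg, Complex.norm_real, Real.norm_eq_abs] at this

theorem circleCoeff_deriv {f : ℝ → ℝ} (hf : ContDiff ℝ 1 f)
    (hp : Function.Periodic f (2 * Real.pi)) (k : ℤ) :
    circleCoeff (deriv f) k = Complex.I * k * circleCoeff f k := by
  have hd : ∀ x : ℝ, HasDerivAt (fun x : ℝ => (f x : ℂ)) (deriv f x : ℝ) x := fun x =>
    ((hf.differentiable one_ne_zero).differentiableAt.hasDerivAt).ofReal_comp
  have he : ∀ x : ℝ, HasDerivAt (fun x : ℝ => Complex.exp (-(Complex.I * k * x)))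
      (-(Complex.I * k) * Complex.exp (-(Complex.I * k * x))) x := by
    intro x
    have h1 : HasDerivAt (fun x : ℝ => -(Complex.I * k * (x : ℂ))) (-(Complex.I * k * 1)) x :=
      ((Complex.ofRealCLM.hasDerivAt (x := x)).const_mul (Complex.I * (k : ℂ))).neg
    convert h1.cexp using 1
    ring
  have hfc : Continuous (deriv f) := hf.continuous_deriv le_rfl
  have key := intervalIntegral.integral_mul_deriv_eq_deriv_mul (a := 0) (b := 2 * Real.pi)
    (fun x _ => he x) (fun x _ => hd x)
    (Continuous.intervalIntegrable (by fun_prop) _ _)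
    (Continuous.intervalIntegrable (by fun_prop) _ _)
  have hend : Complex.exp (-(Complex.I * k * ((2 * Real.pi : ℝ) : ℂ))) = 1 := by
    have : (-(Complex.I * k * ((2 * Real.pi : ℝ) : ℂ))) =
        ((-k : ℤ) : ℂ) * (2 * Real.pi * Complex.I) := by
      push_cast; ring
    rw [this, Complex.exp_int_mul_two_pi_mul_I]
  have hf0 : f (2 * Real.pi) = f 0 := by simpa using hp 0
  rw [hend, hf0] at key
  unfold circleCoeff
  rw [mul_smul_comm, ← intervalIntegral.integral_const_mul]
  congr 1
  simp only [Complex.ofReal_zero, mul_zero, neg_zero, Complex.exp_zero, one_mul, sub_self,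
    zero_sub, mul_comm (Complex.exp _) _] at key
  rw [key, ← intervalIntegral.integral_neg]
  refine intervalIntegral.integral_congr fun x _ => ?_
  ring

theorem norm_le_of_weighted_sq_le {s c k : ℝ} (hs : 0 ≤ s) (hk : 0 < k)
    (h : (1 + k ^ 2) ^ s * c ^ 2 ≤ 1) : c ≤ k ^ (-s) := by
  have h1 : (k ^ s) ^ 2 ≤ (1 + k ^ 2) ^ s := by
    rw [← Real.rpow_natCast, ← Real.rpow_mul hk.le, mul_comm s, Real.rpow_mul hk.le]
    apply Real.rpow_le_rpow (by positivity) _ hs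
    simp
  have hks : 0 < k ^ s := Real.rpow_pos_of_pos hk s
  have h2 : (k ^ s * c) ^ 2 ≤ 1 := by
    rw [mul_pow]
    exact (mul_le_mul_of_nonneg_right h1 (sq_nonneg c)).trans h
  have h3 : k ^ s * c ≤ 1 := by
    nlinarith
  rw [Real.rpow_neg hk.le, ← one_div, le_div_iff₀ hks, mul_comm]
  exact h3

/-- The sum of `|j|⁻²` over the nonzero integers. -/
noncomputable def invSqSum : ℝ := ∑' j : ℤ, 1 / (j : ℝ) ^ 2

theorem hasSum_invSqSum : HasSum (fun j : ℤ => 1 / (j : ℝ) ^ 2) invSqSum :=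
  (Real.summable_one_div_int_pow.2 one_lt_two).hasSum

theorem invSqSum_nonneg : 0 ≤ invSqSum := tsum_nonneg fun _ => by positivity

/-- At the frequency jN the bound |k| · |k|⁻ˢ equals N^(1-s) |j|^(1-s), and s ≥ 3 makes the last
factor at most j⁻². The gain N^(1-s) comes from the short period; it is what makes the nonlinear
error negligible. -/
theorem abs_deriv_le_of_weighted_sq_le {f : ℝ → ℝ} (hf : ContDiff ℝ 1 f) {N : ℕ} (hN : 0 < N)
    (hp : Function.Periodic f (2 * Real.pi / N)) {s : ℝ} (hs : 3 ≤ s)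
    (h : ∀ k : ℤ, (1 + (k : ℝ) ^ 2) ^ s * ‖circleCoeff f k‖ ^ 2 ≤ 1) (x : ℝ) :
    |deriv f x| ≤ (N : ℝ) * (N : ℝ) ^ (-s) * invSqSum := by
  have hN' : (0 : ℝ) < N := Nat.cast_pos.2 hN
  have hp2 : Function.Periodic f (2 * Real.pi) := by
    have := hp.nat_mul N
    rwa [mul_div_cancel₀ _ hN'.ne'] at this
  have hpd : Function.Periodic (deriv f) (2 * Real.pi / N) := by
    intro y
    rw [← deriv_comp_add_const]
    congr 1
    exact funext hp
  refine abs_le_of_norm_circleCoeff_le (hf.continuous_deriv le_rfl) hN hpd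
    (hasSum_invSqSum.mul_left _) (fun j => ?_) x
  rw [circleCoeff_deriv hf hp2]
  -- For j = 0 both sides are 0, the right one because 1 / 0 = 0.
  rcases eq_or_ne j 0 with rfl | hj
  · simp
  have hj0 : (0 : ℝ) < |(j : ℝ)| := abs_pos.2 (Int.cast_ne_zero.2 hj)
  have hj1 : (1 : ℝ) ≤ |(j : ℝ)| := by
    have : (1 : ℤ) ≤ |j| := Int.one_le_abs hj
    exact_mod_cast this
  have hk : 0 < |(j : ℝ)| * N := mul_pos hj0 hN'
  have hc : ‖circleCoeff f (j * N)‖ ≤ (|(j : ℝ)| * N) ^ (-s) := by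
    refine norm_le_of_weighted_sq_le (by linarith) hk ?_
    have := h (j * N)
    rwa [show ((j * N : ℤ) : ℝ) ^ 2 = (|(j : ℝ)| * N) ^ 2 by
      push_cast; rw [mul_pow, mul_pow, sq_abs]] at this
  have hnorm : ‖Complex.I * ((j * N : ℤ) : ℂ)‖ = |(j : ℝ)| * N := by
    rw [norm_mul, Complex.norm_I, one_mul]
    push_cast
    rw [norm_mul, Complex.norm_intCast, Complex.norm_natCast]
  rw [norm_mul, hnorm]
  have hjs : |(j : ℝ)| * |(j : ℝ)| ^ (-s) ≤ 1 / (j : ℝ) ^ 2 := by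
    have h3 : |(j : ℝ)| ^ (-s) ≤ |(j : ℝ)| ^ (-3 : ℝ) :=
      Real.rpow_le_rpow_of_exponent_le hj1 (by linarith)
    have h4 : |(j : ℝ)| ^ (-3 : ℝ) = 1 / (|(j : ℝ)| * (j : ℝ) ^ 2) := by
      rw [Real.rpow_neg hj0.le, show (3 : ℝ) = ((3 : ℕ) : ℝ) by norm_num, Real.rpow_natCast,
        one_div, ← sq_abs (j : ℝ)]
      congr 1
      ring
    calc |(j : ℝ)| * |(j : ℝ)| ^ (-s) ≤ |(j : ℝ)| * (1 / (|(j : ℝ)| * (j : ℝ) ^ 2)) := by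
          rw [← h4]; gcongr
      _ = 1 / (j : ℝ) ^ 2 := by field_simp
  calc |(j : ℝ)| * N * ‖circleCoeff f (j * N)‖ ≤ |(j : ℝ)| * N * (|(j : ℝ)| * N) ^ (-s) := by
        gcongr
    _ = (N : ℝ) * (N : ℝ) ^ (-s) * (|(j : ℝ)| * |(j : ℝ)| ^ (-s)) := by
        rw [Real.mul_rpow hj0.le hN'.le]; ring
    _ ≤ _ := by gcongr

theorem abs_le_of_weighted_sq_le {f : ℝ → ℝ} (hf : Continuous f)
    (hp : Function.Periodic f (2 * Real.pi)) {s : ℝ} (hs : 3 ≤ s)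
    (h : ∀ k : ℤ, (1 + (k : ℝ) ^ 2) ^ s * ‖circleCoeff f k‖ ^ 2 ≤ 1) (x : ℝ) :
    |f x| ≤ 1 + invSqSum := by
  -- The term 1 / j² is 0 at j = 0, so the mean of f needs a separate summand 1 there.
  refine abs_le_of_norm_circleCoeff_le hf one_pos (by simpa using hp)
    ((hasSum_ite_eq (0 : ℤ) (1 : ℝ)).add hasSum_invSqSum) (fun j => ?_) x
  simp only [Nat.cast_one, mul_one]
  rcases eq_or_ne j 0 with rfl | hj
  · have := h 0
    simp only [Int.cast_zero, ne_eq, OfNat.ofNat_ne_zero, not_false_eq_true, zero_pow, add_zero,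
      Real.one_rpow, one_mul] at this
    simp
    nlinarith [norm_nonneg (circleCoeff f 0)]
  have hj0 : (0 : ℝ) < |(j : ℝ)| := abs_pos.2 (Int.cast_ne_zero.2 hj)
  have hj1 : (1 : ℝ) ≤ |(j : ℝ)| := by
    have : (1 : ℤ) ≤ |j| := Int.one_le_abs hj
    exact_mod_cast this
  have hc : ‖circleCoeff f j‖ ≤ |(j : ℝ)| ^ (-s) := by
    refine norm_le_of_weighted_sq_le (by linarith) hj0 ?_
    rw [sq_abs]
    exact h j
  rw [if_neg hj, zero_add]
  refine hc.trans ((Real.rpow_le_rpow_of_exponent_le hj1 (by linarith : -s ≤ -2)).trans_eq ?_)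
  rw [Real.rpow_neg hj0.le, show (2 : ℝ) = ((2 : ℕ) : ℝ) by norm_num, Real.rpow_natCast, sq_abs,
    one_div]

/-! ### Trigonometric fields -/

theorem fourierCoefficient_comp_fst_eq_circleCoeff {g : ℝ → ℝ} (hg : Continuous g) (k : ℤ) :
    fourierCoefficient (fun x => g (x 0)) ![k, 0] = circleCoeff g k :=
  fourierCoefficient_comp_fst_mode hg k

theorem norm_circleCoeff_le {g : ℝ → ℝ} {M : ℝ} (hM : ∀ x, |g x| ≤ M) (k : ℤ) :
    ‖circleCoeff g k‖ ≤ M := by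
  unfold circleCoeff
  have := intervalIntegral.norm_integral_le_of_norm_le_const (a := 0) (b := 2 * Real.pi)
    (f := fun x : ℝ => (g x : ℂ) * Complex.exp (-(Complex.I * k * x))) (C := M) (fun x _ => by
      have : (-(Complex.I * k * x)) = ((-(k * x) : ℝ) : ℂ) * Complex.I := by push_cast; ring
      rw [norm_mul, this, Complex.norm_exp_ofReal_mul_I, mul_one, Complex.norm_real]
      exact hM x)
  rw [norm_smul, Real.norm_eq_abs, abs_of_pos (inv_pos.2 Real.two_pi_pos)]
  rw [sub_zero, abs_of_pos Real.two_pi_pos] at this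
  rw [inv_mul_le_iff₀ Real.two_pi_pos]
  exact this.trans_eq (mul_comm _ _)

/-- The profile `α + β cos(N x) + δ sin(N x)`. -/
noncomputable def trigProfile (N : ℕ) (α β δ x : ℝ) : ℝ :=
  α + β * Real.cos (N * x) + δ * Real.sin (N * x)

theorem continuous_trigProfile (N : ℕ) (α β δ : ℝ) : Continuous (trigProfile N α β δ) := by
  unfold trigProfile
  fun_prop

theorem abs_trigProfile_le (N : ℕ) (α β δ x : ℝ) :
    |trigProfile N α β δ x| ≤ |α| + |β| + |δ| := by
  unfold trigProfile
  have h1 := Real.abs_cos_le_one (N * x)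
  have h2 := Real.abs_sin_le_one (N * x)
  calc |α + β * Real.cos (N * x) + δ * Real.sin (N * x)|
      ≤ |α| + |β * Real.cos (N * x)| + |δ * Real.sin (N * x)| := abs_add_three _ _ _
    _ ≤ |α| + |β| + |δ| := by
      rw [abs_mul, abs_mul]
      have := mul_le_of_le_one_right (abs_nonneg β) h1
      have := mul_le_of_le_one_right (abs_nonneg δ) h2
      linarith

theorem trigProfile_add_period {N : ℕ} (hN : 0 < N) (α β δ x : ℝ) :
    trigProfile N α β δ (x + 2 * Real.pi / N) = trigProfile N α β δ x := by
  have hN' : (N : ℝ) ≠ 0 := Nat.cast_ne_zero.2 hN.ne'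
  unfold trigProfile
  rw [mul_add, mul_div_cancel₀ _ hN', Real.cos_add_two_pi, Real.sin_add_two_pi]

theorem trigProfile_add_two_pi (N : ℕ) (α β δ x : ℝ) :
    trigProfile N α β δ (x + 2 * Real.pi) = trigProfile N α β δ x := by
  unfold trigProfile
  rw [mul_add, Real.cos_add_nat_mul_two_pi, Real.sin_add_nat_mul_two_pi]

theorem circleCoeff_trigProfile_eq_zero {N : ℕ} {k : ℤ} (h0 : k ≠ 0) (h1 : k ≠ N) (h2 : k ≠ -N)
    (α β δ : ℝ) : circleCoeff (trigProfile N α β δ) k = 0 := by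
  have hpt : ∀ x : ℝ, (trigProfile N α β δ x : ℂ) * Complex.exp (-(Complex.I * k * x)) =
      α * Complex.exp (-(Complex.I * k) * x) +
        (β / 2 - δ / 2 * Complex.I) * Complex.exp (-(Complex.I * ((k - N : ℤ) : ℂ)) * x) +
        (β / 2 + δ / 2 * Complex.I) * Complex.exp (-(Complex.I * ((k + N : ℤ) : ℂ)) * x) := by
    intro x
    unfold trigProfile
    push_cast
    have e1 : Complex.exp (-(Complex.I * (k - N)) * x) =
        Complex.exp (N * x * Complex.I) * Complex.exp (-(Complex.I * k) * x) := by
      rw [← Complex.exp_add]; congr 1; ring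
    have e2 : Complex.exp (-(Complex.I * (k + N)) * x) =
        Complex.exp (-(N * x) * Complex.I) * Complex.exp (-(Complex.I * k) * x) := by
      rw [← Complex.exp_add]; congr 1; ring
    rw [e1, e2, Complex.exp_mul_I, Complex.exp_mul_I, Complex.cos_neg, Complex.sin_neg,
      show -(Complex.I * k * x) = -(Complex.I * k) * x by ring]
    ring_nf
    rw [Complex.I_sq]
    ring
  unfold circleCoeff
  simp_rw [hpt]
  rw [intervalIntegral.integral_add, intervalIntegral.integral_add,
    intervalIntegral.integral_const_mul, intervalIntegral.integral_const_mul,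
    intervalIntegral.integral_const_mul, integral_exp_int_mul _ h0,
    integral_exp_int_mul _ (sub_ne_zero.2 h1), integral_exp_int_mul (k + N) (by omega)]
  · simp
  all_goals exact Continuous.intervalIntegrable (by fun_prop) _ _

/-- The field `α + β cos(N x₁) + δ sin(N x₁)`. -/
noncomputable def trigField (N : ℕ) (α β δ : ℝ) (x : Point) : ℝ :=
  trigProfile N α β δ (x 0)

theorem continuous_trigField (N : ℕ) (α β δ : ℝ) : Continuous (trigField N α β δ) :=
  (continuous_trigProfile N α β δ).comp (continuous_apply 0)

theorem isPeriodic_trigField (N : ℕ) (α β δ : ℝ) : IsPeriodic (trigField N α β δ) := by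
  intro x j
  fin_cases j
  · simpa [trigField] using trigProfile_add_two_pi N α β δ (x 0)
  · simp [trigField]

theorem trigField_const (N : ℕ) (α : ℝ) : trigField N α 0 0 = fun _ => α := by
  ext x
  simp [trigField, trigProfile]

theorem sobolevSq_trigField_le {N : ℕ} (α β δ : ℝ) {s : ℝ} (hs : 0 ≤ s) :
    sobolevSq s (trigField N α β δ) ≤
      ENNReal.ofReal (3 * ((1 + (N : ℝ) ^ 2) ^ s * (|α| + |β| + |δ|) ^ 2)) := by
  have hg := continuous_trigProfile N α β δ
  set F : Finset (Fin 2 → ℤ) := {![0, 0], ![(N : ℤ), 0], ![-(N : ℤ), 0]} with hF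
  have hzero : ∀ n ∉ F, fourierCoefficient (trigField N α β δ) n = 0 := by
    intro n hn
    by_cases h1 : n 1 = 0
    · have hn' : n = ![n 0, 0] := by
        ext i; fin_cases i
        · rfl
        · exact h1
      rw [hn'] at hn ⊢
      simp only [hF, Finset.mem_insert, Finset.mem_singleton, not_or, Matrix.vecCons_inj,
        and_true] at hn
      exact (fourierCoefficient_comp_fst_eq_circleCoeff hg _).trans
        (circleCoeff_trigProfile_eq_zero hn.1 hn.2.1 hn.2.2 α β δ)
    · exact fourierCoefficient_comp_fst_of_ne hg h1
  unfold sobolevSq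
  rw [tsum_eq_sum (s := F) (fun n hn => by rw [hzero n hn]; simp)]
  have hterm : ∀ n ∈ F, ENNReal.ofReal ((1 + ∑ j, (n j : ℝ) ^ 2) ^ s *
      ‖fourierCoefficient (trigField N α β δ) n‖ ^ 2) ≤
      ENNReal.ofReal ((1 + (N : ℝ) ^ 2) ^ s * (|α| + |β| + |δ|) ^ 2) := by
    intro n hn
    have hn' : ∃ k : ℤ, n = ![k, 0] ∧ (k : ℝ) ^ 2 ≤ (N : ℝ) ^ 2 := by
      simp only [hF, Finset.mem_insert, Finset.mem_singleton] at hn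
      rcases hn with rfl | rfl | rfl
      · exact ⟨0, rfl, by simp⟩
      · exact ⟨N, rfl, by simp⟩
      · exact ⟨-N, rfl, by simp⟩
    obtain ⟨k, rfl, hk⟩ := hn'
    apply ENNReal.ofReal_le_ofReal
    have hc : ‖fourierCoefficient (trigField N α β δ) ![k, 0]‖ ≤ |α| + |β| + |δ| := by
      refine (congrArg norm (fourierCoefficient_comp_fst_eq_circleCoeff hg k)).trans_le ?_
      exact norm_circleCoeff_le (abs_trigProfile_le N α β δ) k
    have hw : (1 + ∑ j, ((![k, 0] : Fin 2 → ℤ) j : ℝ) ^ 2) = 1 + (k : ℝ) ^ 2 := by simp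
    rw [hw]
    gcongr
  refine (Finset.sum_le_sum hterm).trans ?_
  rw [Finset.sum_const, nsmul_eq_mul, ENNReal.ofReal_mul (by norm_num : (0 : ℝ) ≤ 3)]
  gcongr
  -- Only an inequality: the three frequencies coincide when N = 0.
  have : (F.card : ℝ≥0∞) ≤ (3 : ℕ) := by exact_mod_cast Finset.card_le_three
  simpa using this

/-! ### Partial derivatives -/

section Pderiv

variable {𝕜 : Type*} [RCLike 𝕜]

theorem pderiv_translate (j : Fin 2) (f : Point → 𝕜) (h x : Point) :
    pderiv j (fun y => f (y + h)) x = pderiv j f (x + h) := by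
  unfold pderiv
  rw [fderiv_comp_add_right]

theorem pderiv_const (j : Fin 2) (c : 𝕜) (x : Point) : pderiv j (fun _ => c) x = 0 := by
  simp [pderiv]

theorem hasDerivAt_comp_add_single {f : Point → 𝕜} (j : Fin 2) {x : Point} {r : ℝ}
    (hf : DifferentiableAt ℝ f (x + Pi.single j r)) :
    HasDerivAt (fun r : ℝ => f (x + Pi.single j r)) (pderiv j f (x + Pi.single j r)) r := by
  have h1 : HasDerivAt (fun r : ℝ => x + (Pi.single j r : Point)) (Pi.single j 1) r := by
    have := ((ContinuousLinearMap.single ℝ (fun _ : Fin 2 => ℝ) j).hasDerivAt (x := r)).const_add x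
    simpa using this
  exact hf.hasFDerivAt.comp_hasDerivAt r h1

theorem pderiv_eq_zero_of_invariant {f : Point → 𝕜} {j : Fin 2}
    (hf : ∀ x (r : ℝ), f (x + Pi.single j r) = f x) (x : Point) : pderiv j f x = 0 := by
  by_cases hd : DifferentiableAt ℝ f x
  · have h1 := hasDerivAt_comp_add_single (f := f) j (x := x) (r := 0) (by simpa using hd)
    simp only [hf, Pi.single_zero, add_zero] at h1
    exact h1.unique (hasDerivAt_const 0 (f x))
  -- No differentiability is assumed: elsewhere `fderiv` takes its default value 0.
  · simp [pderiv, fderiv_zero_of_not_differentiableAt hd]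

theorem pderiv_zero_comp_fst {g : ℝ → 𝕜} {x : Point} (hg : DifferentiableAt ℝ g (x 0)) :
    pderiv 0 (fun y : Point => g (y 0)) x = deriv g (x 0) := by
  have h1 : HasFDerivAt (fun y : Point => y 0)
    (ContinuousLinearMap.proj (R := ℝ) (φ := fun _ : Fin 2 => ℝ) 0) x :=
    (ContinuousLinearMap.proj (R := ℝ) (φ := fun _ : Fin 2 => ℝ) 0).hasFDerivAt
  have h2 := hg.hasDerivAt.hasFDerivAt.comp x h1
  unfold pderiv
  rw [show (fun y : Point => g (y 0)) = g ∘ fun y : Point => y 0 from rfl, h2.fderiv]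
  simp

end Pderiv

/-! ### Translations of states and solutions -/

/-- Every component of the state is continuous and periodic. -/
structure ContinuousPeriodic (U : State) : Prop where
  continuous_velocity : ∀ i, Continuous fun x => U.1 x i
  continuous_stress : ∀ i j, Continuous fun x => U.2 x i j
  periodic_velocity : ∀ i, IsPeriodic fun x => U.1 x i
  periodic_stress : ∀ i j, IsPeriodic fun x => U.2 x i j

theorem InPhaseSpace.continuousPeriodic {K : StressSpace} {s : ℝ} {U : State}
    (h : InPhaseSpace K s U) : ContinuousPeriodic U :=
  ⟨h.1, h.2, h.3, h.4⟩

theorem ContinuousPeriodic.sub {U V : State} (hU : ContinuousPeriodic U)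
    (hV : ContinuousPeriodic V) : ContinuousPeriodic (U - V) where
  continuous_velocity i := (hU.1 i).sub (hV.1 i)
  continuous_stress i j := (hU.2 i j).sub (hV.2 i j)
  periodic_velocity i x k := congrArg₂ (· - ·) (hU.3 i x k) (hV.3 i x k)
  periodic_stress i j x k := congrArg₂ (· - ·) (hU.4 i j x k) (hV.4 i j x k)

/-- The state translated by `h`. -/
def translate (h : Point) (U : State) : State := (fun x => U.1 (x + h), fun x => U.2 (x + h))

theorem IsPeriodic.translate {f : Point → ℝ} (hf : IsPeriodic f) (h : Point) :
    IsPeriodic fun x => f (x + h) := by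
  intro x j
  simp only
  rw [add_right_comm, hf]

/-- Only continuity and periodicity are required, so that the lemma also applies to the differences
U(t) - U(t₀) in the definition of C([0, T]; H^s). -/
theorem sobolevNorm_translate {U : State} (hU : ContinuousPeriodic U) (h : Point) (s : ℝ) :
    sobolevNorm s (translate h U) = sobolevNorm s U := by
  unfold sobolevNorm translate
  congr 2
  · exact Finset.sum_congr rfl fun i _ => sobolevSq_translate (hU.1 i) (hU.3 i) h s
  · exact Finset.sum_congr rfl fun i _ => Finset.sum_congr rfl fun j _ =>
      sobolevSq_translate (hU.2 i j) (hU.4 i j) h s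

theorem InPhaseSpace.translate {K : StressSpace} {s : ℝ} {U : State} (hU : InPhaseSpace K s U)
    (h : Point) : InPhaseSpace K s (translate h U) where
  continuous_velocity i := (hU.continuous_velocity i).comp (by fun_prop)
  continuous_stress i j := (hU.continuous_stress i j).comp (by fun_prop)
  periodic_velocity i := (hU.periodic_velocity i).translate h
  periodic_stress i j := (hU.periodic_stress i j).translate h
  finite_norm := by
    rw [sobolevNorm_translate hU.continuousPeriodic]
    exact hU.finite_norm
  div_free x := by
    rw [← hU.div_free (x + h)]
    exact Finset.sum_congr rfl fun j _ => pderiv_translate j (fun y => U.1 y j) h x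
  mean_zero i :=
    (setIntegral_cell_add (hU.continuous_velocity i) (hU.periodic_velocity i) h).trans
      (hU.mean_zero i)
  stress_mem x := hU.stress_mem (x + h)

theorem ContDiffOn.comp_translate {T : ℝ} {F : ℝ × Point → ℝ}
    (hF : ContDiffOn ℝ 1 F (Set.Icc 0 T ×ˢ Set.univ)) (h : Point) :
    ContDiffOn ℝ 1 (fun z : ℝ × Point => F (z.1, z.2 + h)) (Set.Icc 0 T ×ˢ Set.univ) :=
  hF.comp (g := F) (f := fun z : ℝ × Point => (z.1, z.2 + h)) (by fun_prop)
    fun _ hz => ⟨hz.1, Set.mem_univ _⟩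

theorem IsSolution.translate {b ε : ℝ} {K : StressSpace} {s T : ℝ} {U : ℝ → State}
    (hU : IsSolution b ε K s T U) (h : Point) :
    IsSolution b ε K s T (fun t => translate h (U t)) where
  inPhaseSpace t ht := (hU.inPhaseSpace t ht).translate h
  contDiff_velocity i := ContDiffOn.comp_translate (hU.contDiff_velocity i) h
  contDiff_stress i j := ContDiffOn.comp_translate (hU.contDiff_stress i j) h
  momentum := by
    obtain ⟨p, hp, heq⟩ := hU.momentum
    refine ⟨fun t x => p t (x + h), fun t ht => ⟨(hp t ht).1.comp (by fun_prop),
      (hp t ht).2.translate h⟩, fun t ht x i => ?_⟩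
    have := heq t ht (x + h) i
    simp only [EulerOldroydB.translate, divTensor] at this ⊢
    simp only [← pderiv_translate] at this
    exact this
  stress := by
    intro t ht x i j
    have := hU.stress t ht (x + h) i j
    simp only [EulerOldroydB.translate, grad] at this ⊢
    simp only [← pderiv_translate] at this
    exact this

/-- The equations have no explicit dependence on x. Together with uniqueness this passes every
translation symmetry of a datum on to its solution. -/
theorem SolvesFrom.translate {b ε : ℝ} {K : StressSpace} {C : TimeClass} {s T : ℝ}
    {U₀ : State} {U : ℝ → State} (hU : SolvesFrom b ε K C s T U₀ U) (h : Point) :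
    SolvesFrom b ε K C s T (translate h U₀) (fun t => translate h (U t)) := by
  obtain ⟨hsol, hmem, h0⟩ := hU
  have hper : ∀ t ∈ Set.Icc 0 T, ContinuousPeriodic (U t) := fun t ht =>
    (hsol.inPhaseSpace t ht).continuousPeriodic
  refine ⟨hsol.translate h, ?_, congrArg (EulerOldroydB.translate h) h0⟩
  cases C with
  | bounded =>
    obtain ⟨M, hM, hb⟩ := hmem
    exact ⟨M, hM, fun t ht => by rw [sobolevNorm_translate (hper t ht)]; exact hb t ht⟩
  | continuous =>
    intro t₀ ht₀
    refine (hmem t₀ ht₀).congr' ?_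
    filter_upwards [self_mem_nhdsWithin] with t ht
    exact (sobolevNorm_translate ((hper t ht).sub (hper t₀ ht₀)) h s).symm

/-! ### Shear data and the relaxing background -/

/-- Zero velocity and constant diagonal stress. -/
def diagState (a₁ a₂ : ℝ) : State := (fun _ _ => 0, fun _ => !![a₁, 0; 0, a₂])

/-- The diagonal state perturbed by a shear mode of frequency `N` and amplitude `d`. -/
noncomputable def shearState (N : ℕ) (a₁ a₂ d : ℝ) : State :=
  (fun x => ![0, trigField N 0 d 0 x],
    fun x => !![a₁, trigField N 0 0 d x; trigField N 0 0 d x, a₂])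

theorem shearState_zero (N : ℕ) (a₁ a₂ : ℝ) : shearState N a₁ a₂ 0 = diagState a₁ a₂ := by
  unfold shearState diagState
  rw [trigField_const]
  congr 1
  ext x i
  fin_cases i <;> rfl

theorem isotropicState_eq_diagState (a : ℝ) : isotropicState a = diagState a a := by
  unfold isotropicState diagState
  congr 1
  ext x i j
  fin_cases i <;> fin_cases j <;> simp

theorem shearState_sub_diagState (N : ℕ) (a₁ a₂ d : ℝ) :
    shearState N a₁ a₂ d - diagState a₁ a₂ = shearState N 0 0 d := by
  unfold shearState diagState
  ext x i
  · fin_cases i <;> simp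
  · rename_i j
    fin_cases i <;> fin_cases j <;> simp

theorem diagState_sub (a₁ a₂ c₁ c₂ : ℝ) :
    diagState a₁ a₂ - diagState c₁ c₂ = diagState (a₁ - c₁) (a₂ - c₂) := by
  unfold diagState
  ext x i
  · simp
  · rename_i j
    fin_cases i <;> fin_cases j <;> simp

theorem shearState_velocity (N : ℕ) (a₁ a₂ d : ℝ) (i : Fin 2) : ∃ α β δ : ℝ,
    (fun x => (shearState N a₁ a₂ d).1 x i) = trigField N α β δ ∧ |α| + |β| + |δ| ≤ |a₁| + |a₂| + |d| := by
  fin_cases i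
  · exact ⟨0, 0, 0, by rw [trigField_const]; rfl, by simp; positivity⟩
  · exact ⟨0, d, 0, rfl, by simp; positivity⟩

theorem shearState_stress (N : ℕ) (a₁ a₂ d : ℝ) (i j : Fin 2) : ∃ α β δ : ℝ,
    (fun x => (shearState N a₁ a₂ d).2 x i j) = trigField N α β δ ∧ |α| + |β| + |δ| ≤ |a₁| + |a₂| + |d| := by
  have h1 := abs_nonneg a₁
  have h2 := abs_nonneg a₂
  have h3 := abs_nonneg d
  fin_cases i <;> fin_cases j
  · exact ⟨a₁, 0, 0, by rw [trigField_const]; rfl, by simp; linarith⟩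
  · exact ⟨0, 0, d, rfl, by simp; linarith⟩
  · exact ⟨0, 0, d, rfl, by simp; linarith⟩
  · exact ⟨a₂, 0, 0, by rw [trigField_const]; rfl, by simp; linarith⟩

/-- The constant is 18 = 6 · 3: six scalar components with at most three frequencies each. -/
theorem sobolevNorm_shearState_le {N : ℕ} (a₁ a₂ d : ℝ) {s : ℝ} (hs : 0 ≤ s) :
    sobolevNorm s (shearState N a₁ a₂ d) ≤
      ENNReal.ofReal (18 * ((1 + (N : ℝ) ^ 2) ^ s * (|a₁| + |a₂| + |d|) ^ 2)) ^ (1 / 2 : ℝ) := by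
  have hb : ∀ α β δ : ℝ, |α| + |β| + |δ| ≤ |a₁| + |a₂| + |d| →
      sobolevSq s (trigField N α β δ) ≤
        ENNReal.ofReal (3 * ((1 + (N : ℝ) ^ 2) ^ s * (|a₁| + |a₂| + |d|) ^ 2)) := by
    intro α β δ h
    refine (sobolevSq_trigField_le α β δ hs).trans (ENNReal.ofReal_le_ofReal ?_)
    gcongr
  unfold sobolevNorm
  refine ENNReal.rpow_le_rpow ?_ (by norm_num)
  have h6 : (18 * ((1 + (N : ℝ) ^ 2) ^ s * (|a₁| + |a₂| + |d|) ^ 2)) =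
      6 * (3 * ((1 + (N : ℝ) ^ 2) ^ s * (|a₁| + |a₂| + |d|) ^ 2)) := by ring
  rw [h6, ENNReal.ofReal_mul (by norm_num : (0 : ℝ) ≤ 6)]
  have hv : ∀ i, sobolevSq s (fun x => (shearState N a₁ a₂ d).1 x i) ≤ _ := fun i => by
    obtain ⟨α, β, δ, h, hle⟩ := shearState_velocity N a₁ a₂ d i
    rw [h]; exact hb α β δ hle
  have hτ : ∀ i j, sobolevSq s (fun x => (shearState N a₁ a₂ d).2 x i j) ≤ _ := fun i j => by
    obtain ⟨α, β, δ, h, hle⟩ := shearState_stress N a₁ a₂ d i j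
    rw [h]; exact hb α β δ hle
  refine (add_le_add (Finset.sum_le_sum fun i _ => hv i)
    (Finset.sum_le_sum fun i _ => Finset.sum_le_sum fun j _ => hτ i j)).trans_eq ?_
  simp only [Finset.sum_const, Finset.card_univ, Fintype.card_fin, nsmul_eq_mul]
  rw [show ENNReal.ofReal 6 = 6 by simp]
  push_cast
  ring

theorem inPhaseSpace_shearState (K : StressSpace) {s : ℝ} (hs : 0 ≤ s) {N : ℕ} (hN : 0 < N)
    (a₁ a₂ d : ℝ) : InPhaseSpace K s (shearState N a₁ a₂ d) where
  continuous_velocity i := by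
    obtain ⟨α, β, δ, h, -⟩ := shearState_velocity N a₁ a₂ d i
    rw [h]; exact continuous_trigField N α β δ
  continuous_stress i j := by
    obtain ⟨α, β, δ, h, -⟩ := shearState_stress N a₁ a₂ d i j
    rw [h]; exact continuous_trigField N α β δ
  periodic_velocity i := by
    obtain ⟨α, β, δ, h, -⟩ := shearState_velocity N a₁ a₂ d i
    rw [h]; exact isPeriodic_trigField N α β δ
  periodic_stress i j := by
    obtain ⟨α, β, δ, h, -⟩ := shearState_stress N a₁ a₂ d i j
    rw [h]; exact isPeriodic_trigField N α β δ
  finite_norm := (sobolevNorm_shearState_le a₁ a₂ d hs).trans_lt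
    (ENNReal.rpow_lt_top_of_nonneg (by norm_num) ENNReal.ofReal_ne_top)
  div_free x := by
    rw [divVec, Fin.sum_univ_two, pderiv_eq_zero_of_invariant (j := 0),
      pderiv_eq_zero_of_invariant (j := 1), add_zero]
    · intro x r; simp [shearState, trigField]
    · intro x r; simp [shearState]
  mean_zero i := by
    fin_cases i
    · simp [shearState]
    · have hN' : (N : ℝ) ≠ 0 := Nat.cast_ne_zero.2 hN.ne'
      refine (setIntegral_cell (continuous_trigField N 0 d 0)).trans ?_
      have : ∫ x in (0 : ℝ)..2 * Real.pi, Real.cos (N * x) = 0 := by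
        rw [intervalIntegral.integral_comp_mul_left (fun y => Real.cos y) hN', integral_cos]
        have := Real.sin_add_nat_mul_two_pi 0 N
        rw [zero_add, Real.sin_zero] at this
        simp [this]
      simp [trigField, trigProfile, this]
  stress_mem x := by
    cases K with
    | general => exact Set.mem_univ _
    | symmetric =>
      ext i j
      fin_cases i <;> fin_cases j <;> rfl

theorem inPhaseSpace_diagState (K : StressSpace) {s : ℝ} (hs : 0 ≤ s) (a₁ a₂ : ℝ) :
    InPhaseSpace K s (diagState a₁ a₂) := by
  -- Frequency 1, since zero mean of the velocity mode needs N > 0.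
  rw [← shearState_zero 1]
  exact inPhaseSpace_shearState K hs one_pos a₁ a₂ 0

theorem sobolevNorm_diagState_le (a₁ a₂ : ℝ) {s : ℝ} (hs : 0 ≤ s) :
    sobolevNorm s (diagState a₁ a₂) ≤
      ENNReal.ofReal (18 * (|a₁| + |a₂|) ^ 2) ^ (1 / 2 : ℝ) := by
  -- Frequency 0 makes the weight (1 + N²)ˢ equal to 1.
  rw [← shearState_zero 0]
  simpa using sobolevNorm_shearState_le (N := 0) a₁ a₂ 0 hs

/-- The background: a constant diagonal stress that relaxes at the rate `γ`. -/
noncomputable def relaxingState (γ a₁ a₂ t : ℝ) : State :=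
  diagState (Real.exp (-(γ * t)) * a₁) (Real.exp (-(γ * t)) * a₂)

/-- For a fluid at rest with spatially constant stress all gradients vanish and only τ' = -γτ
remains. This is the reference solution in the continuous dependence. -/
theorem solvesFrom_relaxingState (b ε : ℝ) (K : StressSpace) (C : TimeClass) {s : ℝ}
    (hs : 0 ≤ s) {T : ℝ} (hT : 0 < T) (a₁ a₂ : ℝ) :
    SolvesFrom b ε K C s T (diagState a₁ a₂) (relaxingState (1 / ε ^ 2) a₁ a₂) := by
  set γ := 1 / ε ^ 2 with hγ
  have hder : ∀ c, ∀ t ∈ Set.Icc 0 T,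
      derivWithin (fun r => Real.exp (-(γ * r)) * c) (Set.Icc 0 T) t =
        -γ * (Real.exp (-(γ * t)) * c) := by
    intro c t ht
    have h1 : HasDerivAt (fun r => Real.exp (-(γ * r)) * c)
        (Real.exp (-(γ * t)) * (-(γ * 1)) * c) t :=
      (((hasDerivAt_id t).const_mul γ).neg.exp).mul_const c
    rw [h1.hasDerivWithinAt.derivWithin (uniqueDiffOn_Icc hT t ht)]
    ring
  have hgrad : ∀ t x, grad (relaxingState γ a₁ a₂ t).1 x = 0 := by
    intro t x
    ext i j
    simp [grad, relaxingState, diagState, pderiv_const]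
  have hcomp : ∀ i j : Fin 2, ∃ c : ℝ, ∀ t x,
      (relaxingState γ a₁ a₂ t).2 x i j = Real.exp (-(γ * t)) * c := by
    intro i j
    fin_cases i <;> fin_cases j
    · exact ⟨a₁, fun _ _ => rfl⟩
    · exact ⟨0, fun _ _ => by simp [relaxingState, diagState]⟩
    · exact ⟨0, fun _ _ => by simp [relaxingState, diagState]⟩
    · exact ⟨a₂, fun _ _ => rfl⟩
  refine ⟨?_, ?_, by simp [relaxingState]⟩
  · refine ⟨fun t _ => inPhaseSpace_diagState K hs _ _, fun i => contDiffOn_const,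
      fun i j => ?_, ⟨fun _ _ => 0, fun _ _ => ⟨contDiff_const, fun _ _ => rfl⟩, ?_⟩, ?_⟩
    · obtain ⟨c, hc⟩ := hcomp i j
      simp only [hc]
      fun_prop
    · intro t ht x i
      have : divTensor (relaxingState γ a₁ a₂ t).2 x i = 0 := by
        simp [divTensor, relaxingState, diagState, pderiv_const]
      rw [this]
      simp [relaxingState, diagState, pderiv_const]
    · intro t ht x i j
      obtain ⟨c, hc⟩ := hcomp i j
      rw [hgrad]
      simp only [hc, pderiv_const, hder c t ht]
      simp [rotationQ, symPart, skewPart, hγ]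
  · cases C with
    | bounded =>
      obtain ⟨M, hM⟩ := (isCompact_Icc (a := (0 : ℝ)) (b := T)).exists_bound_of_continuousOn
        (f := fun t => 18 * (|Real.exp (-(γ * t)) * a₁| + |Real.exp (-(γ * t)) * a₂|) ^ 2)
        (by fun_prop)
      refine ⟨ENNReal.ofReal M ^ (1 / 2 : ℝ),
        ENNReal.rpow_lt_top_of_nonneg (by norm_num) ENNReal.ofReal_ne_top, fun t ht => ?_⟩
      refine (sobolevNorm_diagState_le _ _ hs).trans ?_
      gcongr
      exact (le_abs_self _).trans (hM t ht)
    | continuous =>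
      intro t₀ _
      have hlim : Filter.Tendsto (fun t : ℝ => ENNReal.ofReal
          (18 * (|Real.exp (-(γ * t)) * a₁ - Real.exp (-(γ * t₀)) * a₁| +
            |Real.exp (-(γ * t)) * a₂ - Real.exp (-(γ * t₀)) * a₂|) ^ 2) ^ (1 / 2 : ℝ))
          (nhdsWithin t₀ (Set.Icc 0 T)) (nhds 0) := by
        have hc : Continuous (fun t : ℝ => ENNReal.ofReal
          (18 * (|Real.exp (-(γ * t)) * a₁ - Real.exp (-(γ * t₀)) * a₁| +
            |Real.exp (-(γ * t)) * a₂ - Real.exp (-(γ * t₀)) * a₂|) ^ 2) ^ (1 / 2 : ℝ)) :=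
          ENNReal.continuous_rpow_const.comp (ENNReal.continuous_ofReal.comp (by fun_prop))
        have := hc.tendsto t₀
        simp only [sub_self, abs_zero, add_zero, ne_eq, OfNat.ofNat_ne_zero, not_false_eq_true,
          zero_pow, mul_zero, ENNReal.ofReal_zero] at this
        rw [ENNReal.zero_rpow_of_pos (by norm_num)] at this
        exact this.mono_left nhdsWithin_le_nhds
      refine tendsto_of_tendsto_of_tendsto_of_le_of_le tendsto_const_nhds hlim
        (fun _ => zero_le) fun t => ?_
      simp only [relaxingState, diagState_sub]
      exact sobolevNorm_diagState_le _ _ hs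

/-! ### Reduction to shear flows -/

/-- The equations of a shear flow `u = (0, v(t, x₁))` with stress depending on `(t, x₁)`: here
`σ = τ₂₁`, `ρ = τ₁₂` and `A = (τ₂₂ - τ₁₁) + b (τ₁₁ + τ₂₂)`. -/
structure ShearFlow (b γ T : ℝ) (v σ ρ A : ℝ → ℝ → ℝ) : Prop where
  contDiff_velocity :
    ContDiffOn ℝ 1 (fun z : ℝ × ℝ => v z.1 z.2) (Set.Icc 0 T ×ˢ Set.univ)
  contDiff_shear : ContDiffOn ℝ 1 (fun z : ℝ × ℝ => σ z.1 z.2) (Set.Icc 0 T ×ˢ Set.univ)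
  contDiff_normal : ContDiffOn ℝ 1 (fun z : ℝ × ℝ => A z.1 z.2) (Set.Icc 0 T ×ˢ Set.univ)
  velocity : ∀ t ∈ Set.Icc 0 T, ∀ x,
    HasDerivWithinAt (fun r => v r x) (deriv (σ t) x) (Set.Icc 0 T) t
  shear : ∀ t ∈ Set.Icc 0 T, ∀ x,
    HasDerivWithinAt (fun r => σ r x) (-γ * σ t x + (γ - A t x) / 2 * deriv (v t) x)
      (Set.Icc 0 T) t
  normal : ∀ t ∈ Set.Icc 0 T, ∀ x,
    HasDerivWithinAt (fun r => A r x)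
      (-γ * A t x + (1 - b ^ 2) * (ρ t x + σ t x) * deriv (v t) x) (Set.Icc 0 T) t

theorem contDiff_slice {E : Type*} [NormedAddCommGroup E] [NormedSpace ℝ E] {T : ℝ}
    {F : ℝ × E → ℝ} (hF : ContDiffOn ℝ 1 F (Set.Icc 0 T ×ˢ Set.univ)) {t : ℝ}
    (ht : t ∈ Set.Icc 0 T) : ContDiff ℝ 1 fun x => F (t, x) := by
  rw [← contDiffOn_univ]
  exact hF.comp (g := F) (f := fun x => (t, x)) (by fun_prop) fun x _ => ⟨ht, Set.mem_univ x⟩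

theorem differentiableWithinAt_time {E : Type*} [NormedAddCommGroup E] [NormedSpace ℝ E] {T : ℝ}
    {F : ℝ × E → ℝ} (hF : ContDiffOn ℝ 1 F (Set.Icc 0 T ×ˢ Set.univ)) (x : E) {t : ℝ}
    (ht : t ∈ Set.Icc 0 T) : DifferentiableWithinAt ℝ (fun r => F (r, x)) (Set.Icc 0 T) t :=
  (hF.comp (g := F) (f := fun r => (r, x)) (s := Set.Icc 0 T) (by fun_prop) fun r hr => ⟨hr, Set.mem_univ x⟩).differentiableOn
      one_ne_zero t ht

/-- The derivative of a function along the direction `j` vanishes if it is constant along this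
direction and the function is periodic. -/
theorem eq_zero_of_pderiv_const_of_periodic {p : Point → ℝ} (hp : ContDiff ℝ 1 p)
    (hper : IsPeriodic p) {j : Fin 2} {q : ℝ} {x : Point}
    (hq : ∀ r : ℝ, pderiv j p (x + Pi.single j r) = q) : q = 0 := by
  have hd : ∀ r : ℝ, HasDerivAt (fun r : ℝ => p (x + Pi.single j r) - q * r) 0 r := by
    intro r
    have h1 := hasDerivAt_comp_add_single (f := p) j (x := x) (r := r)
      (hp.differentiable one_ne_zero _)
    rw [hq] at h1
    have h2 := h1.fun_sub ((hasDerivAt_id r).const_mul q)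
    simpa using h2
  have hc := is_const_of_deriv_eq_zero (fun r => (hd r).differentiableAt)
    (fun r => (hd r).deriv) (2 * Real.pi) 0
  simp only [Pi.single_zero, add_zero, mul_zero, sub_zero, hper x j] at hc
  have : q * (2 * Real.pi) = 0 := by linarith
  exact (mul_eq_zero.1 this).resolve_right Real.two_pi_pos.ne'

theorem eq_comp_fst_of_invariant {α : Type*} {f : Point → α}
    (hf : ∀ x (r : ℝ), f (x + Pi.single 1 r) = f x) (x : Point) : f x = f (Pi.single 0 (x 0)) := by
  rw [← hf (Pi.single 0 (x 0)) (x 1)]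
  congr 1
  ext i
  fin_cases i <;> simp

theorem pderiv_zero_single {f : Point → ℝ} (hd : ContDiff ℝ 1 f)
    (r : ℝ) :
    pderiv 0 f (Pi.single 0 r) = deriv (fun r : ℝ => f (Pi.single 0 r)) r := by
  have h1 := hasDerivAt_comp_add_single (f := f) 0 (x := 0) (r := r)
    (hd.differentiable one_ne_zero _)
  simp only [zero_add] at h1
  exact h1.deriv.symm

/-- A divergence-free mean-zero velocity field that depends on the first variable only has no first
component. -/
theorem InPhaseSpace.velocity_zero_eq_zero {K : StressSpace} {s : ℝ} {U : State}
    (hU : InPhaseSpace K s U) (hd : ContDiff ℝ 1 fun x => U.1 x 0)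
    (hf : ∀ x (r : ℝ), U.1 (x + Pi.single 1 r) = U.1 x) (x : Point) : U.1 x 0 = 0 := by
  have h1 : ∀ y, pderiv 0 (fun x => U.1 x 0) y = 0 := by
    intro y
    have := hU.div_free y
    rwa [divVec, Fin.sum_univ_two, pderiv_eq_zero_of_invariant (j := 1)
      (fun x r => by rw [hf]), add_zero] at this
  have hconst : ∀ y : Point, U.1 y 0 = U.1 0 0 := by
    intro y
    rw [eq_comp_fst_of_invariant (f := fun x => U.1 x 0) (fun x r => by simp only [hf]) y]
    have hd : ∀ r : ℝ, HasDerivAt (fun r : ℝ => U.1 (Pi.single 0 r) 0) 0 r := by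
      intro r
      have h2 := hasDerivAt_comp_add_single (f := fun x => U.1 x 0) 0 (x := 0) (r := r)
        (hd.differentiable one_ne_zero _)
      rw [h1] at h2
      simpa using h2
    have hc := is_const_of_deriv_eq_zero (fun r => (hd r).differentiableAt)
      (fun r => (hd r).deriv) (y 0) 0
    simpa using hc
  have hint := hU.mean_zero 0
  rw [setIntegral_cell (hU.continuous_velocity 0)] at hint
  simp only [hconst] at hint
  simp only [intervalIntegral.integral_const, sub_zero, smul_eq_mul, mul_eq_zero,
    Real.two_pi_pos.ne', false_or] at hint
  rw [hconst, hint]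

/-- Invariance in x₂ removes ∂₂, and with ∇·u = 0 and zero mean also u₁. So there is no transport,
and ∇u has the single entry w = ∂₁u₂. Then Q₂₁ = wA/2, which singles out the combination A, and Q₁₁
and Q₂₂ equal (w/2)(τ₁₂ + τ₂₁) times b + 1 and b - 1, whence the coefficient 1 - b². -/
theorem IsSolution.shearFlow {b ε : ℝ} {K : StressSpace} {s T : ℝ} {V : ℝ → State}
    (hV : IsSolution b ε K s T V)
    (hinv : ∀ t ∈ Set.Icc 0 T, ∀ r : ℝ, EulerOldroydB.translate (Pi.single 1 r) (V t) = V t) :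
    ShearFlow b (1 / ε ^ 2) T (fun t x => (V t).1 (Pi.single 0 x) 1)
      (fun t x => (V t).2 (Pi.single 0 x) 1 0) (fun t x => (V t).2 (Pi.single 0 x) 0 1)
      (fun t x => ((V t).2 (Pi.single 0 x) 1 1 - (V t).2 (Pi.single 0 x) 0 0) +
        b * ((V t).2 (Pi.single 0 x) 0 0 + (V t).2 (Pi.single 0 x) 1 1)) := by
  have hi1 : ∀ t ∈ Set.Icc 0 T, ∀ x (r : ℝ), (V t).1 (x + Pi.single 1 r) = (V t).1 x :=
    fun t ht x r => congrFun (congrArg Prod.fst (hinv t ht r)) x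
  have hi2 : ∀ t ∈ Set.Icc 0 T, ∀ x (r : ℝ), (V t).2 (x + Pi.single 1 r) = (V t).2 x :=
    fun t ht x r => congrFun (congrArg Prod.snd (hinv t ht r)) x
  have hline : ContDiff ℝ 1 fun x : ℝ => (Pi.single 0 x : Point) :=
    (ContinuousLinearMap.single ℝ (fun _ : Fin 2 => ℝ) 0).contDiff
  have hmap : ∀ {F : ℝ × Point → ℝ}, ContDiffOn ℝ 1 F (Set.Icc 0 T ×ˢ Set.univ) →
      ContDiffOn ℝ 1 (fun z : ℝ × ℝ => F (z.1, Pi.single 0 z.2)) (Set.Icc 0 T ×ˢ Set.univ) := by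
    intro F hF
    refine hF.comp (g := F) (f := fun z : ℝ × ℝ => (z.1, (Pi.single 0 z.2 : Point)))
      (ContDiff.contDiffOn (contDiff_fst.prodMk (hline.comp contDiff_snd)))
      fun z hz => ⟨hz.1, Set.mem_univ _⟩
  have hs1 : ∀ t ∈ Set.Icc 0 T, ∀ i, ContDiff ℝ 1 fun x => (V t).1 x i := fun t ht i =>
    contDiff_slice (hV.contDiff_velocity i) ht
  have hs2 : ∀ t ∈ Set.Icc 0 T, ∀ i j, ContDiff ℝ 1 fun x => (V t).2 x i j := fun t ht i j =>
    contDiff_slice (hV.contDiff_stress i j) ht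
  have hu0 : ∀ t ∈ Set.Icc 0 T, ∀ x, (V t).1 x 0 = 0 := fun t ht x =>
    (hV.inPhaseSpace t ht).velocity_zero_eq_zero (hs1 t ht 0) (hi1 t ht) x
  have hp1 : ∀ t ∈ Set.Icc 0 T, ∀ i x, pderiv 1 (fun y => (V t).1 y i) x = 0 :=
    fun t ht i x => pderiv_eq_zero_of_invariant (fun x r => by rw [hi1 t ht]) x
  have hp2 : ∀ t ∈ Set.Icc 0 T, ∀ i j x, pderiv 1 (fun y => (V t).2 y i j) x = 0 :=
    fun t ht i j x => pderiv_eq_zero_of_invariant (fun x r => by rw [hi2 t ht]) x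
  have hp0 : ∀ t ∈ Set.Icc 0 T, ∀ x, pderiv 0 (fun y => (V t).1 y 0) x = 0 := by
    intro t ht x
    simp only [hu0 t ht]
    exact pderiv_const 0 0 x
  have hstress : ∀ t ∈ Set.Icc 0 T, ∀ x i j, HasDerivWithinAt (fun r => (V r).2 x i j)
      (1 / ε ^ 2 * (symPart (grad (V t).1 x) i j - (V t).2 x i j) -
        rotationQ b ((V t).2 x) (grad (V t).1 x) i j) (Set.Icc 0 T) t := by
    intro t ht x i j
    have h1 := (differentiableWithinAt_time (hV.contDiff_stress i j) x ht).hasDerivWithinAt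
    have h2 := hV.stress t ht x i j
    rw [Fin.sum_univ_two, hu0 t ht, hp2 t ht] at h2
    refine h1.congr_deriv ?_
    rw [← h2]
    ring
  have hgrad : ∀ t ∈ Set.Icc 0 T, ∀ x : ℝ, grad (V t).1 (Pi.single 0 x) =
      !![0, 0; deriv (fun x : ℝ => (V t).1 (Pi.single 0 x) 1) x, 0] := by
    intro t ht x
    ext i j
    fin_cases i <;> fin_cases j
    · simp [grad, hp0 t ht]
    · simp [grad, hp1 t ht]
    · simp only [grad, Matrix.of_apply]
      exact pderiv_zero_single (hs1 t ht 1) x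
    · simp [grad, hp1 t ht]
  refine ⟨hmap (hV.contDiff_velocity 1), hmap (hV.contDiff_stress 1 0), ?_, ?_, ?_, ?_⟩
  · have h0 := hmap (hV.contDiff_stress 0 0)
    have h1 := hmap (hV.contDiff_stress 1 1)
    exact (h1.sub h0).add (contDiffOn_const.mul (h0.add h1))
  · intro t ht x
    obtain ⟨p, hp, heq⟩ := hV.momentum
    -- The pressure is not known to be invariant in x₂. The momentum equation shows that ∂₂p is
    -- constant along x₂, and periodicity of p then forces this constant to be 0.
    have h1 : ∀ r : ℝ, pderiv 1 (p t) (Pi.single 0 x + Pi.single 1 r) =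
        deriv (fun x : ℝ => (V t).2 (Pi.single 0 x) 1 0) x -
          derivWithin (fun r => (V r).1 (Pi.single 0 x) 1) (Set.Icc 0 T) t := by
      intro r
      have h2 := heq t ht (Pi.single 0 x + Pi.single 1 r) 1
      have h3 : derivWithin (fun r' => (V r').1 (Pi.single 0 x + Pi.single 1 r) 1)
          (Set.Icc 0 T) t = derivWithin (fun r => (V r).1 (Pi.single 0 x) 1) (Set.Icc 0 T) t :=
        derivWithin_congr (fun t' ht' => by rw [hi1 t' ht']) (by rw [hi1 t ht])
      have h4 : divTensor (V t).2 (Pi.single 0 x + Pi.single 1 r) 1 =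
          deriv (fun x : ℝ => (V t).2 (Pi.single 0 x) 1 0) x := by
        rw [divTensor, Fin.sum_univ_two, hp2 t ht, add_zero, ← pderiv_translate]
        simp only [hi2 t ht]
        exact pderiv_zero_single (hs2 t ht 1 0) x
      rw [Fin.sum_univ_two, hu0 t ht, hp1 t ht, h3, h4] at h2
      linarith
    have h5 := eq_zero_of_pderiv_const_of_periodic (hp t ht).1 (hp t ht).2 h1
    have h6 := (differentiableWithinAt_time (hV.contDiff_velocity 1)
      (Pi.single 0 x : Point) ht).hasDerivWithinAt
    exact h6.congr_deriv (sub_eq_zero.1 h5).symm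
  · intro t ht x
    have h1 := hstress t ht (Pi.single 0 x) 1 0
    rw [hgrad t ht x] at h1
    refine h1.congr_deriv ?_
    simp [rotationQ, symPart, skewPart, Matrix.mul_apply, Fin.sum_univ_two]
    ring
  · intro t ht x
    have h00 := hstress t ht (Pi.single 0 x) 0 0
    have h11 := hstress t ht (Pi.single 0 x) 1 1
    rw [hgrad t ht x] at h00 h11
    refine ((h11.fun_sub h00).fun_add ((h00.fun_add h11).const_mul b)).congr_deriv ?_
    simp [rotationQ, symPart, skewPart, Matrix.mul_apply, Fin.sum_univ_two]
    ring

/-! ### Growth of a Fourier mode of a shear flow -/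

/-- At interior times the given derivative is the time derivative of a jointly C¹ field; its
continuity on a compact neighbourhood supplies the dominating constant. -/
theorem hasDerivAt_integral_mul {T : ℝ} {F : ℝ → ℝ → ℝ}
    (hF : ContDiffOn ℝ 1 (fun z : ℝ × ℝ => F z.1 z.2) (Set.Icc 0 T ×ˢ Set.univ)) {g : ℝ → ℝ}
    (hg : Continuous g) {t : ℝ} (ht : t ∈ Set.Ioo 0 T) {d : ℝ → ℝ}
    (hd : ∀ x, HasDerivWithinAt (fun r => F r x) (d x) (Set.Icc 0 T) t) (a b : ℝ) :
    HasDerivAt (fun r => ∫ x in a..b, F r x * g x) (∫ x in a..b, d x * g x) t := by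
  have hopen : IsOpen (Set.Ioo 0 T ×ˢ (Set.univ : Set ℝ)) := isOpen_Ioo.prod isOpen_univ
  have hFo : ContDiffOn ℝ 1 (fun z : ℝ × ℝ => F z.1 z.2) (Set.Ioo 0 T ×ˢ Set.univ) :=
    hF.mono (Set.prod_mono_left Set.Ioo_subset_Icc_self)
  have hcont := hFo.continuousOn_fderiv_of_isOpen hopen le_rfl
  set D : ℝ → ℝ → ℝ := fun r x => fderiv ℝ (fun z : ℝ × ℝ => F z.1 z.2) (r, x) (1, 0) with hD
  have hDc : ContinuousOn (fun z : ℝ × ℝ => D z.1 z.2) (Set.Ioo 0 T ×ˢ Set.univ) :=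
    hcont.clm_apply continuousOn_const
  have hDd : ∀ r ∈ Set.Ioo 0 T, ∀ x, HasDerivAt (fun r => F r x) (D r x) r := by
    intro r hr x
    have h1 : HasFDerivAt (fun z : ℝ × ℝ => F z.1 z.2)
        (fderiv ℝ (fun z : ℝ × ℝ => F z.1 z.2) (r, x)) (r, x) :=
      ((hFo.differentiableOn one_ne_zero).differentiableAt
        (hopen.mem_nhds ⟨hr, Set.mem_univ x⟩)).hasFDerivAt
    have h2 : HasDerivAt (fun r : ℝ => (r, x)) (1, 0) r :=
      (hasDerivAt_id r).prodMk (hasDerivAt_const r x)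
    exact h1.comp_hasDerivAt (f := fun r : ℝ => (r, x)) r h2
  have hdD : ∀ x, d x = D t x := fun x =>
    ((hd x).hasDerivAt (Icc_mem_nhds ht.1 ht.2)).unique (hDd t ht x)
  simp_rw [hdD]
  obtain ⟨δ, hδ, hball⟩ := Metric.isOpen_iff.1 isOpen_Ioo t ht
  have hball' : Set.Icc (t - δ / 2) (t + δ / 2) ⊆ Set.Ioo 0 T := by
    intro r hr
    apply hball
    rw [Metric.mem_ball, Real.dist_eq, abs_lt]
    constructor <;> linarith [hr.1, hr.2]
  have hsl : ∀ r ∈ Set.Ioo 0 T, Continuous fun x => F r x := fun r hr =>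
    (contDiff_slice hF (Set.Ioo_subset_Icc_self hr)).continuous
  have hDsl : Continuous fun x => D t x := by
    rw [← continuousOn_univ]
    exact hDc.comp (f := fun x => (t, x)) (by fun_prop) fun x _ => ⟨ht, Set.mem_univ x⟩
  obtain ⟨M, hM⟩ := (isCompact_Icc.prod (isCompact_uIcc (a := a) (b := b))).exists_bound_of_continuousOn
    (s := Set.Icc (t - δ / 2) (t + δ / 2) ×ˢ Set.uIcc a b) (f := fun z : ℝ × ℝ => D z.1 z.2 * g z.2)
    ((hDc.mono (Set.prod_mono hball' (Set.subset_univ _))).mul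
      (hg.comp continuous_snd).continuousOn)
  have hnhds : Set.Icc (t - δ / 2) (t + δ / 2) ∈ nhds t :=
    Icc_mem_nhds (by linarith) (by linarith)
  refine (intervalIntegral.hasDerivAt_integral_of_dominated_loc_of_deriv_le
    (F := fun r x => F r x * g x) (F' := fun r x => D r x * g x) (bound := fun _ => M) hnhds ?_
    (((hsl t ht).mul hg).intervalIntegrable _ _) ((hDsl.mul hg).aestronglyMeasurable) ?_
    intervalIntegrable_const ?_).2
  · filter_upwards [hnhds] with r hr
    exact ((hsl r (hball' hr)).mul hg).aestronglyMeasurable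
  · exact Filter.Eventually.of_forall fun x hx r hr => hM (r, x) ⟨hr, Set.uIoc_subset_uIcc hx⟩
  · exact Filter.Eventually.of_forall fun x _ r hr => (hDd r (hball' hr) x).mul_const (g x)

theorem continuousOn_integral_mul {T : ℝ} (hT : 0 ≤ T) {F : ℝ → ℝ → ℝ}
    (hF : ContDiffOn ℝ 1 (fun z : ℝ × ℝ => F z.1 z.2) (Set.Icc 0 T ×ˢ Set.univ)) {g : ℝ → ℝ}
    (hg : Continuous g) (a b : ℝ) :
    ContinuousOn (fun r => ∫ x in a..b, F r x * g x) (Set.Icc 0 T) := by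
  -- Extending F constantly in time beyond [0, T] makes it continuous on the whole plane.
  have h1 : Continuous fun z : ℝ × ℝ => F (Set.projIcc 0 T hT z.1) z.2 :=
    hF.continuousOn.comp_continuous (f := fun z : ℝ × ℝ => ((Set.projIcc 0 T hT z.1 : ℝ), z.2))
      (by fun_prop) fun z => ⟨Subtype.coe_prop _, Set.mem_univ _⟩
  have h2 : Continuous fun r => ∫ x in a..b, F (Set.projIcc 0 T hT r) x * g x :=
    intervalIntegral.continuous_parametric_intervalIntegral_of_continuous'
      (h1.mul (hg.comp continuous_snd)) a b
  refine h2.continuousOn.congr fun r hr => ?_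
  simp only [Set.projIcc_of_mem hT hr]

/-- The function e^(-ρt)(Φ - K/ρ) is nondecreasing. The derivative is needed in the open interval
only; continuity covers the end points. -/
theorem exp_mul_sub_le_of_deriv_ge {T ρ K : ℝ} (hT : 0 ≤ T) (hρ : 0 < ρ) {Φ Φ' : ℝ → ℝ}
    (hc : ContinuousOn Φ (Set.Icc 0 T)) (hd : ∀ t ∈ Set.Ioo 0 T, HasDerivAt Φ (Φ' t) t)
    (h : ∀ t ∈ Set.Ioo 0 T, ρ * Φ t - K ≤ Φ' t) :
    Real.exp (ρ * T) * (Φ 0 - K / ρ) ≤ Φ T - K / ρ := by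
  set Ψ : ℝ → ℝ := fun t => Real.exp (-(ρ * t)) * (Φ t - K / ρ) with hΨ
  have hder : ∀ t ∈ Set.Ioo 0 T, HasDerivAt Ψ
      (Real.exp (-(ρ * t)) * (-(ρ * 1)) * (Φ t - K / ρ) + Real.exp (-(ρ * t)) * Φ' t) t :=
    fun t ht => ((hasDerivAt_id t).const_mul ρ).neg.exp.mul ((hd t ht).sub_const _)
  have hmono : MonotoneOn Ψ (Set.Icc 0 T) := by
    refine monotoneOn_of_deriv_nonneg (convex_Icc 0 T) ?_ ?_ ?_
    · exact (by fun_prop : Continuous fun t : ℝ => Real.exp (-(ρ * t))).continuousOn.mul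
        (hc.sub continuousOn_const)
    · rw [interior_Icc]
      exact fun t ht => (hder t ht).differentiableAt.differentiableWithinAt
    · rw [interior_Icc]
      intro t ht
      rw [(hder t ht).deriv]
      have h1 := h t ht
      have h2 : Real.exp (-(ρ * t)) * (-(ρ * 1)) * (Φ t - K / ρ) + Real.exp (-(ρ * t)) * Φ' t =
          Real.exp (-(ρ * t)) * (Φ' t - (ρ * Φ t - K)) := by
        field_simp
        ring
      rw [h2]
      exact mul_nonneg (Real.exp_pos _).le (by linarith)
  have := hmono (Set.left_mem_Icc.2 hT) (Set.right_mem_Icc.2 hT) hT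
  simp only [hΨ, mul_zero, neg_zero, Real.exp_zero, one_mul] at this
  calc Real.exp (ρ * T) * (Φ 0 - K / ρ)
      ≤ Real.exp (ρ * T) * (Real.exp (-(ρ * T)) * (Φ T - K / ρ)) := by gcongr
    _ = Φ T - K / ρ := by rw [← mul_assoc, ← Real.exp_add]; simp

theorem integral_deriv_mul_cos {f : ℝ → ℝ} (hf : ContDiff ℝ 1 f)
    (hp : Function.Periodic f (2 * Real.pi)) (N : ℕ) :
    ∫ x in (0 : ℝ)..2 * Real.pi, deriv f x * Real.cos (N * x) =
      N * ∫ x in (0 : ℝ)..2 * Real.pi, f x * Real.sin (N * x) := by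
  have hd : ∀ x, HasDerivAt (fun x : ℝ => Real.cos (N * x)) (-Real.sin (N * x) * (N * 1)) x :=
    fun x => ((hasDerivAt_id x).const_mul (N : ℝ)).cos
  have hfc := hf.continuous_deriv le_rfl
  have key := intervalIntegral.integral_mul_deriv_eq_deriv_mul (a := 0) (b := 2 * Real.pi)
    (fun x _ => hd x) (fun x _ => ((hf.differentiable one_ne_zero).differentiableAt.hasDerivAt))
    (Continuous.intervalIntegrable (by fun_prop) _ _)
    (Continuous.intervalIntegrable (by fun_prop) _ _)
  have hf0 : f (2 * Real.pi) = f 0 := by simpa using hp 0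
  have hc : Real.cos (N * (2 * Real.pi)) = 1 := Real.cos_nat_mul_two_pi N
  rw [hf0, hc, mul_zero, Real.cos_zero, sub_self, zero_sub] at key
  simp_rw [mul_comm (deriv f _)]
  rw [key, ← intervalIntegral.integral_neg, ← intervalIntegral.integral_const_mul]
  refine intervalIntegral.integral_congr fun x _ => ?_
  ring

theorem integral_deriv_mul_sin {f : ℝ → ℝ} (hf : ContDiff ℝ 1 f)
    (hp : Function.Periodic f (2 * Real.pi)) (N : ℕ) :
    ∫ x in (0 : ℝ)..2 * Real.pi, deriv f x * Real.sin (N * x) =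
      -(N * ∫ x in (0 : ℝ)..2 * Real.pi, f x * Real.cos (N * x)) := by
  have hd : ∀ x, HasDerivAt (fun x : ℝ => Real.sin (N * x)) (Real.cos (N * x) * (N * 1)) x :=
    fun x => ((hasDerivAt_id x).const_mul (N : ℝ)).sin
  have hfc := hf.continuous_deriv le_rfl
  have key := intervalIntegral.integral_mul_deriv_eq_deriv_mul (a := 0) (b := 2 * Real.pi)
    (fun x _ => hd x) (fun x _ => ((hf.differentiable one_ne_zero).differentiableAt.hasDerivAt))
    (Continuous.intervalIntegrable (by fun_prop) _ _)
    (Continuous.intervalIntegrable (by fun_prop) _ _)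
  have hf0 : f (2 * Real.pi) = f 0 := by simpa using hp 0
  have hc : Real.sin (N * (2 * Real.pi)) = 0 := by
    have := Real.sin_add_nat_mul_two_pi 0 N
    rwa [zero_add, Real.sin_zero] at this
  rw [hf0, hc, mul_zero, Real.sin_zero, sub_self, zero_sub] at key
  simp_rw [mul_comm (deriv f _)]
  rw [key, ← intervalIntegral.integral_const_mul]
  congr 1
  refine intervalIntegral.integral_congr fun x _ => ?_
  ring

theorem ShearFlow.mono {b γ T T' : ℝ} {v σ ρ A : ℝ → ℝ → ℝ} (h : ShearFlow b γ T v σ ρ A)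
    (hT : T' ≤ T) : ShearFlow b γ T' v σ ρ A := by
  have hsub : Set.Icc 0 T' ⊆ Set.Icc 0 T := Set.Icc_subset_Icc_right hT
  have hsub' := Set.prod_mono_left (t := (Set.univ : Set ℝ)) hsub
  exact ⟨h.1.mono hsub', h.2.mono hsub', h.3.mono hsub',
    fun t ht x => (h.4 t (hsub ht) x).mono hsub, fun t ht x => (h.5 t (hsub ht) x).mono hsub,
    fun t ht x => (h.6 t (hsub ht) x).mono hsub⟩

/-- The integrating factor e^(γt) removes the damping of A and leaves a source that is linear in
v_x, hence O(G). -/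
theorem ShearFlow.abs_normal_sub_le {b γ T : ℝ} (hγ : 0 ≤ γ) {v σ ρ A : ℝ → ℝ → ℝ}
    (h : ShearFlow b γ T v σ ρ A) {A₀ C G : ℝ} (hA : ∀ x, A 0 x = A₀)
    (hC : ∀ t ∈ Set.Icc 0 T, ∀ x, |ρ t x + σ t x| ≤ C)
    (hG : ∀ t ∈ Set.Icc 0 T, ∀ x, |deriv (v t) x| ≤ G) :
    ∀ t ∈ Set.Icc 0 T, ∀ x, |A t x - A₀ * Real.exp (-(γ * t))| ≤
      |1 - b ^ 2| * C * T * Real.exp (γ * T) * G := by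
  intro t ht x
  have hT : 0 ≤ T := ht.1.trans ht.2
  have hC0 : 0 ≤ C := (abs_nonneg _).trans (hC t ht x)
  have hG0 : 0 ≤ G := (abs_nonneg _).trans (hG t ht x)
  have hd : ∀ r ∈ Set.Icc 0 T, HasDerivWithinAt (fun r => Real.exp (γ * r) * A r x)
      (Real.exp (γ * r) * ((1 - b ^ 2) * (ρ r x + σ r x) * deriv (v r) x)) (Set.Icc 0 T) r := by
    intro r hr
    have h1 : HasDerivAt (fun r => Real.exp (γ * r)) (Real.exp (γ * r) * (γ * 1)) r :=
      ((hasDerivAt_id r).const_mul γ).exp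
    refine (h1.hasDerivWithinAt.fun_mul (h.normal r hr x)).congr_deriv ?_
    ring
  have hb : ∀ r ∈ Set.Ico 0 T,
      ‖Real.exp (γ * r) * ((1 - b ^ 2) * (ρ r x + σ r x) * deriv (v r) x)‖ ≤
        Real.exp (γ * T) * (|1 - b ^ 2| * C * G) := by
    intro r hr
    have hr' := Set.Ico_subset_Icc_self hr
    rw [Real.norm_eq_abs, abs_mul, Real.abs_exp, abs_mul, abs_mul]
    have := hC r hr' x
    have := hG r hr' x
    gcongr
    exact hr.2.le
  have key := norm_image_sub_le_of_norm_deriv_le_segment' hd hb t ht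
  rw [mul_zero, Real.exp_zero, one_mul, hA, Real.norm_eq_abs, sub_zero] at key
  have h2 : A t x - A₀ * Real.exp (-(γ * t)) =
      Real.exp (-(γ * t)) * (Real.exp (γ * t) * A t x - A₀) := by
    rw [mul_sub, ← mul_assoc, ← Real.exp_add]
    simp
    ring
  rw [h2, abs_mul, Real.abs_exp]
  have h3 : Real.exp (-(γ * t)) ≤ 1 := Real.exp_le_one_iff.2 (by nlinarith [ht.1])
  calc Real.exp (-(γ * t)) * |Real.exp (γ * t) * A t x - A₀|
      ≤ 1 * (Real.exp (γ * T) * (|1 - b ^ 2| * C * G) * T) := by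
        gcongr
        refine key.trans ?_
        gcongr
        exact ht.2
    _ = _ := by ring

/-- Let a and S be the integrals of v cos(Nx) and σ sin(Nx). Then a' = NS and S' = -γS + cNa - f/2,
where c = (A₀e^(-γt) - γ)/2 ≥ μ and f collects the deviation of A. As c > 0, both NS² and cNa² push
the product aS upwards, so aS detects the growing mode without diagonalizing a time-dependent
system. -/
theorem ShearFlow.exp_growth {b γ T : ℝ} (hT : 0 < T) (hγ : 0 ≤ γ) {v σ ρ A : ℝ → ℝ → ℝ}
    (h : ShearFlow b γ T v σ ρ A) {A₀ C G B μ : ℝ} (hA : ∀ x, A 0 x = A₀)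
    (hC : ∀ t ∈ Set.Icc 0 T, ∀ x, |ρ t x + σ t x| ≤ C)
    (hG : ∀ t ∈ Set.Icc 0 T, ∀ x, |deriv (v t) x| ≤ G)
    (hpv : ∀ t ∈ Set.Icc 0 T, Function.Periodic (v t) (2 * Real.pi))
    (hpσ : ∀ t ∈ Set.Icc 0 T, Function.Periodic (σ t) (2 * Real.pi))
    (hμ : 0 < μ) (hμ1 : μ ≤ 1)
    (hell : ∀ t ∈ Set.Icc 0 T, μ ≤ (A₀ * Real.exp (-(γ * t)) - γ) / 2)
    {N : ℕ} (hN : 0 < N) (hNγ : γ ≤ μ * N)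
    (hv : ∀ t ∈ Set.Icc 0 T, |∫ x in (0 : ℝ)..2 * Real.pi, v t x * Real.cos (N * x)| ≤ B)
    (hσ : ∀ t ∈ Set.Icc 0 T, |∫ x in (0 : ℝ)..2 * Real.pi, σ t x * Real.sin (N * x)| ≤ B) :
    Real.exp (μ * N * T) * ((∫ x in (0 : ℝ)..2 * Real.pi, v 0 x * Real.cos (N * x)) *
        (∫ x in (0 : ℝ)..2 * Real.pi, σ 0 x * Real.sin (N * x)) -
          Real.pi * (|1 - b ^ 2| * C * T * Real.exp (γ * T)) * G ^ 2 * B / (μ * N)) ≤ B ^ 2 := by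
  set a : ℝ → ℝ := fun t => ∫ x in (0 : ℝ)..2 * Real.pi, v t x * Real.cos (N * x) with ha
  set S : ℝ → ℝ := fun t => ∫ x in (0 : ℝ)..2 * Real.pi, σ t x * Real.sin (N * x) with hS
  set D := |1 - b ^ 2| * C * T * Real.exp (γ * T) with hDdef
  have hN' : (0 : ℝ) < N := Nat.cast_pos.2 hN
  have h0 : (0 : ℝ) ∈ Set.Icc 0 T := Set.left_mem_Icc.2 hT.le
  have hC0 : 0 ≤ C := (abs_nonneg _).trans (hC 0 h0 0)
  have hG0 : 0 ≤ G := (abs_nonneg _).trans (hG 0 h0 0)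
  have hB0 : 0 ≤ B := (abs_nonneg _).trans (hv 0 h0)
  have hD0 : 0 ≤ D := by positivity
  have hcos : Continuous fun x : ℝ => Real.cos (N * x) := by fun_prop
  have hsin : Continuous fun x : ℝ => Real.sin (N * x) := by fun_prop
  set f : ℝ → ℝ := fun t => ∫ x in (0 : ℝ)..2 * Real.pi,
    (A t x - A₀ * Real.exp (-(γ * t))) * deriv (v t) x * Real.sin (N * x) with hf
  have hfb : ∀ t ∈ Set.Icc 0 T, |f t| ≤ 2 * Real.pi * (D * G ^ 2) := by
    intro t ht
    have := intervalIntegral.norm_integral_le_of_norm_le_const (a := 0) (b := 2 * Real.pi)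
      (f := fun x => (A t x - A₀ * Real.exp (-(γ * t))) * deriv (v t) x * Real.sin (N * x))
      (C := D * G ^ 2) (fun x _ => by
        rw [Real.norm_eq_abs, abs_mul, abs_mul]
        have h1 := h.abs_normal_sub_le hγ hA hC hG t ht x
        have h2 := hG t ht x
        have h3 := Real.abs_sin_le_one (N * x)
        calc _ ≤ D * G * G * 1 := by gcongr
          _ = D * G ^ 2 := by ring)
    rw [sub_zero, abs_of_pos Real.two_pi_pos, Real.norm_eq_abs] at this
    linarith
  have hda : ∀ t ∈ Set.Ioo 0 T, HasDerivAt a (N * S t) t := by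
    intro t ht
    have ht' := Set.Ioo_subset_Icc_self ht
    have h1 := hasDerivAt_integral_mul h.contDiff_velocity hcos ht
      (fun x => h.velocity t ht' x) 0 (2 * Real.pi)
    rwa [integral_deriv_mul_cos (contDiff_slice h.contDiff_shear ht') (hpσ t ht')] at h1
  have hdS : ∀ t ∈ Set.Ioo 0 T, HasDerivAt S
      (-γ * S t + (A₀ * Real.exp (-(γ * t)) - γ) / 2 * (N * a t) - f t / 2) t := by
    intro t ht
    have ht' := Set.Ioo_subset_Icc_self ht
    have h1 := hasDerivAt_integral_mul h.contDiff_shear hsin ht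
      (fun x => h.shear t ht' x) 0 (2 * Real.pi)
    refine h1.congr_deriv ?_
    have hvs := contDiff_slice h.contDiff_velocity ht'
    have hcv : Continuous (deriv (v t)) := hvs.continuous_deriv le_rfl
    have hcσ : Continuous (σ t) := (contDiff_slice h.contDiff_shear ht').continuous
    have hcA : Continuous (A t) := (contDiff_slice h.contDiff_normal ht').continuous
    have h2 : ∀ x, (-γ * σ t x + (γ - A t x) / 2 * deriv (v t) x) * Real.sin (N * x) =
        -γ * (σ t x * Real.sin (N * x)) +
          -((A₀ * Real.exp (-(γ * t)) - γ) / 2) * (deriv (v t) x * Real.sin (N * x)) +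
          -(1 / 2) * ((A t x - A₀ * Real.exp (-(γ * t))) * deriv (v t) x * Real.sin (N * x)) := by
      intro x; ring
    simp_rw [h2]
    rw [intervalIntegral.integral_add, intervalIntegral.integral_add,
      intervalIntegral.integral_const_mul, intervalIntegral.integral_const_mul,
      intervalIntegral.integral_const_mul, integral_deriv_mul_sin hvs (hpv t ht')]
    · simp only [ha, hS, hf]
      ring
    all_goals exact Continuous.intervalIntegrable (by fun_prop) _ _
  -- K bounds a f/2, since |a| ≤ B and |f| ≤ 2πDG².
  have key := exp_mul_sub_le_of_deriv_ge (Φ := fun t => a t * S t)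
    (Φ' := fun t => N * S t * S t +
      a t * (-γ * S t + (A₀ * Real.exp (-(γ * t)) - γ) / 2 * (N * a t) - f t / 2))
    (K := Real.pi * D * G ^ 2 * B) hT.le (mul_pos hμ hN')
    ((continuousOn_integral_mul hT.le h.contDiff_velocity hcos _ _).mul
      (continuousOn_integral_mul hT.le h.contDiff_shear hsin _ _))
    (fun t ht => (hda t ht).mul (hdS t ht)) (fun t ht => by
      have ht' := Set.Ioo_subset_Icc_self ht
      have hc := hell t ht'
      set c := (A₀ * Real.exp (-(γ * t)) - γ) / 2
      have e1 : a t * f t ≤ B * (2 * Real.pi * (D * G ^ 2)) := by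
        refine (le_abs_self _).trans ?_
        rw [abs_mul]
        exact mul_le_mul (hv t ht') (hfb t ht') (abs_nonneg _) hB0
      have e2 : μ * N * (a t) ^ 2 ≤ c * N * (a t) ^ 2 := by gcongr
      have e3 : μ * N * (S t) ^ 2 ≤ N * (S t) ^ 2 := by
        have : μ * N ≤ 1 * N := by gcongr
        nlinarith [sq_nonneg (S t)]
      -- By e2 and e3 the good terms are at least μN(a² + S²). Since γ ≤ μN and 2aS ≤ a² + S², they
      -- dominate (μN + γ)aS, which pays for the growth rate and for the damping.
      have e4 : 0 ≤ μ * N * (a t - S t) ^ 2 := by positivity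
      have e6 : 0 ≤ γ * (a t - S t) ^ 2 := mul_nonneg hγ (sq_nonneg _)
      have e8 : 0 ≤ (μ * N - γ) * ((a t) ^ 2 + (S t) ^ 2) :=
        mul_nonneg (by linarith) (by positivity)
      linarith)
  have hfin : a T * S T ≤ B ^ 2 := by
    have hTm : T ∈ Set.Icc 0 T := Set.right_mem_Icc.2 hT.le
    refine (le_abs_self _).trans ?_
    rw [abs_mul, sq]
    exact mul_le_mul (hv T hTm) (hσ T hTm) (abs_nonneg _) hB0
  have hK : 0 ≤ Real.pi * D * G ^ 2 * B / (μ * N) := by positivity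
  linarith

/-! ### Ill-posedness at anisotropic and isotropic constant stresses -/

theorem weighted_sq_le_of_sobolevSq_le_one {s : ℝ} {f : Point → ℝ} (h : sobolevSq s f ≤ 1)
    (n : Fin 2 → ℤ) :
    (1 + ∑ j, (n j : ℝ) ^ 2) ^ s * ‖fourierCoefficient f n‖ ^ 2 ≤ 1 :=
  ENNReal.ofReal_le_one.1 ((ENNReal.le_tsum n).trans h)

theorem sobolevSq_le_one_of_sobolevNorm_le_one {s : ℝ} {U : State} (h : sobolevNorm s U ≤ 1) :
    (∀ i, sobolevSq s (fun x => U.1 x i) ≤ 1) ∧ ∀ i j, sobolevSq s (fun x => U.2 x i j) ≤ 1 := by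
  have hsum : (∑ i, sobolevSq s (fun x => U.1 x i)) +
      ∑ i, ∑ j, sobolevSq s (fun x => U.2 x i j) ≤ 1 := by
    by_contra! hlt
    exact absurd h (not_le.2 (ENNReal.one_lt_rpow hlt (by norm_num)))
  constructor
  · intro i
    exact ((Finset.single_le_sum (f := fun i => sobolevSq s (fun x => U.1 x i))
      (fun _ _ => zero_le) (Finset.mem_univ i)).trans le_self_add).trans hsum
  · intro i j
    exact (((Finset.single_le_sum (f := fun j => sobolevSq s (fun x => U.2 x i j))
      (fun _ _ => zero_le) (Finset.mem_univ j)).trans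
        (Finset.single_le_sum (f := fun i => ∑ j, sobolevSq s (fun x => U.2 x i j))
          (fun _ _ => zero_le) (Finset.mem_univ i))).trans le_add_self).trans hsum

theorem integral_mul_exp_eq {f : ℝ → ℝ} (hf : Continuous f) (N : ℕ) :
    ∫ x in (0 : ℝ)..2 * Real.pi, (f x : ℂ) * Complex.exp (-(Complex.I * (N : ℤ) * x)) =
      ((∫ x in (0 : ℝ)..2 * Real.pi, f x * Real.cos (N * x) : ℝ) : ℂ) -
        ((∫ x in (0 : ℝ)..2 * Real.pi, f x * Real.sin (N * x) : ℝ) : ℂ) * Complex.I := by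
  rw [← intervalIntegral.integral_ofReal, ← intervalIntegral.integral_ofReal,
    ← intervalIntegral.integral_mul_const, ← intervalIntegral.integral_sub]
  · refine intervalIntegral.integral_congr fun x _ => ?_
    have : -(Complex.I * (N : ℤ) * x) = (-(N * x : ℝ) : ℂ) * Complex.I := by push_cast; ring
    rw [this, Complex.exp_mul_I, Complex.cos_neg, Complex.sin_neg]
    push_cast
    ring
  all_goals exact Continuous.intervalIntegrable (by fun_prop) _ _

theorem abs_integral_mul_cos_sin_le {f : ℝ → ℝ} (hf : Continuous f) {N : ℕ} {q : ℝ}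
    (h : ‖circleCoeff f N‖ ≤ q) :
    |∫ x in (0 : ℝ)..2 * Real.pi, f x * Real.cos (N * x)| ≤ 2 * Real.pi * q ∧
      |∫ x in (0 : ℝ)..2 * Real.pi, f x * Real.sin (N * x)| ≤ 2 * Real.pi * q := by
  unfold circleCoeff at h
  rw [integral_mul_exp_eq hf, norm_smul, Real.norm_eq_abs, abs_of_pos (inv_pos.2 Real.two_pi_pos),
    inv_mul_le_iff₀ Real.two_pi_pos] at h
  constructor
  · have := Complex.abs_re_le_norm (((∫ x in (0 : ℝ)..2 * Real.pi, f x * Real.cos (N * x) : ℝ) : ℂ)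
      - ((∫ x in (0 : ℝ)..2 * Real.pi, f x * Real.sin (N * x) : ℝ) : ℂ) * Complex.I)
    simp only [Complex.sub_re, Complex.ofReal_re, Complex.mul_re, Complex.I_re, mul_zero,
      Complex.ofReal_im, Complex.I_im, mul_one, sub_self, sub_zero] at this
    exact this.trans h
  · have := Complex.abs_im_le_norm (((∫ x in (0 : ℝ)..2 * Real.pi, f x * Real.cos (N * x) : ℝ) : ℂ)
      - ((∫ x in (0 : ℝ)..2 * Real.pi, f x * Real.sin (N * x) : ℝ) : ℂ) * Complex.I)
    simp only [Complex.sub_im, Complex.ofReal_im, Complex.mul_im, Complex.I_re, mul_zero,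
      Complex.ofReal_re, Complex.I_im, mul_one, zero_sub, add_zero, abs_neg] at this
    exact this.trans h

theorem integral_cos_sq_nat {N : ℕ} (hN : 0 < N) :
    ∫ x in (0 : ℝ)..2 * Real.pi, Real.cos (N * x) * Real.cos (N * x) = Real.pi := by
  have hN' : (N : ℝ) ≠ 0 := Nat.cast_ne_zero.2 hN.ne'
  have hs : Real.sin (N * (2 * Real.pi)) = 0 := by
    have := Real.sin_add_nat_mul_two_pi 0 N
    rwa [zero_add, Real.sin_zero] at this
  simp_rw [← sq]
  rw [intervalIntegral.integral_comp_mul_left (fun y => Real.cos y ^ 2) hN', integral_cos_sq, hs]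
  simp
  field_simp

theorem integral_sin_sq_nat {N : ℕ} (hN : 0 < N) :
    ∫ x in (0 : ℝ)..2 * Real.pi, Real.sin (N * x) * Real.sin (N * x) = Real.pi := by
  have hN' : (N : ℝ) ≠ 0 := Nat.cast_ne_zero.2 hN.ne'
  have hs : Real.sin (N * (2 * Real.pi)) = 0 := by
    have := Real.sin_add_nat_mul_two_pi 0 N
    rwa [zero_add, Real.sin_zero] at this
  simp_rw [← sq]
  rw [intervalIntegral.integral_comp_mul_left (fun y => Real.sin y ^ 2) hN', integral_sin_sq, hs]
  simp
  field_simp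

theorem translate_shearState_single_one (N : ℕ) (a₁ a₂ d r : ℝ) :
    translate (Pi.single 1 r) (shearState N a₁ a₂ d) = shearState N a₁ a₂ d := by
  simp [translate, shearState, trigField]

theorem translate_shearState_single_zero {N : ℕ} (hN : 0 < N) (a₁ a₂ d : ℝ) :
    translate (Pi.single 0 (2 * Real.pi / N)) (shearState N a₁ a₂ d) = shearState N a₁ a₂ d := by
  simp [translate, shearState, trigField, trigProfile_add_period hN]

/-- Since 1 + N² ≤ 2N², the amplitude dN⁻ˢ gives an H^s norm bounded in terms of d and s alone; N
can be chosen after d. -/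
theorem sobolevNorm_shearState_zero_le {N : ℕ} (hN : 0 < N) (d : ℝ) {s : ℝ} (hs : 0 ≤ s) :
    sobolevNorm s (shearState N 0 0 (d * (N : ℝ) ^ (-s))) ≤
      ENNReal.ofReal (18 * (2 ^ s * d ^ 2)) ^ (1 / 2 : ℝ) := by
  have hN' : (0 : ℝ) < N := Nat.cast_pos.2 hN
  have hN1 : (1 : ℝ) ≤ N := Nat.one_le_cast.2 hN
  refine (sobolevNorm_shearState_le 0 0 _ hs).trans ?_
  gcongr ENNReal.ofReal (18 * ?_) ^ (1 / 2 : ℝ)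
  rw [abs_zero, zero_add, zero_add, sq_abs, mul_pow]
  have h1 : (1 + (N : ℝ) ^ 2) ^ s ≤ 2 ^ s * ((N : ℝ) ^ s) ^ 2 := by
    have h3 : ((N : ℝ) ^ s) ^ 2 = ((N : ℝ) ^ 2) ^ s := by
      rw [← Real.rpow_mul_natCast hN'.le, mul_comm, Real.rpow_natCast_mul hN'.le]
    rw [h3, ← Real.mul_rpow (by norm_num) (by positivity)]
    exact Real.rpow_le_rpow (by positivity) (by nlinarith) hs
  have h2 : (N : ℝ) ^ s * (N : ℝ) ^ (-s) = 1 := by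
    rw [← Real.rpow_add hN', add_neg_cancel, Real.rpow_zero]
  calc (1 + (N : ℝ) ^ 2) ^ s * (d ^ 2 * ((N : ℝ) ^ (-s)) ^ 2)
      ≤ 2 ^ s * ((N : ℝ) ^ s) ^ 2 * (d ^ 2 * ((N : ℝ) ^ (-s)) ^ 2) := by gcongr
    _ = 2 ^ s * d ^ 2 * ((N : ℝ) ^ s * (N : ℝ) ^ (-s)) ^ 2 := by ring
    _ = 2 ^ s * d ^ 2 := by rw [h2]; ring

theorem exists_small_amplitude (s : ℝ) {r : ℝ≥0∞} (hr : 0 < r) :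
    ∃ d : ℝ, 0 < d ∧ ENNReal.ofReal (18 * (2 ^ s * d ^ 2)) ^ (1 / 2 : ℝ) < r := by
  have hc : Continuous fun d : ℝ => ENNReal.ofReal (18 * (2 ^ s * d ^ 2)) ^ (1 / 2 : ℝ) :=
    ENNReal.continuous_rpow_const.comp (ENNReal.continuous_ofReal.comp (by fun_prop))
  have h0 := hc.tendsto 0
  simp only [ne_eq, OfNat.ofNat_ne_zero, not_false_eq_true, zero_pow, mul_zero,
    ENNReal.ofReal_zero] at h0
  rw [ENNReal.zero_rpow_of_pos (by norm_num)] at h0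
  have h1 := (h0.mono_left (nhdsWithin_le_nhds (s := Set.Ioi 0))).eventually (gt_mem_nhds hr)
  obtain ⟨d, hd, hd'⟩ := (h1.and self_mem_nhdsWithin).exists
  exact ⟨d, hd', hd⟩

/-- A shear mode of frequency `N` and size `d N⁻ˢ` around the relaxing background cannot stay in the
unit ball of `H^s` unless `N` is bounded in terms of `d`. -/
theorem exp_growth_of_solution {b ε : ℝ} (hε : 0 < ε) {K : StressSpace} {s T T' : ℝ} (hs : 3 ≤ s)
    (hT' : 0 < T') (hTT' : T' ≤ T) {a₁ a₂ d μ : ℝ} {N : ℕ} (hN : 0 < N) {V : ℝ → State}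
    (hV : IsSolution b ε K s T V) (hV0 : V 0 = shearState N a₁ a₂ (d * (N : ℝ) ^ (-s)))
    (hinv : ∀ t ∈ Set.Icc 0 T, ∀ r : ℝ, translate (Pi.single 1 r) (V t) = V t)
    (hper : ∀ t ∈ Set.Icc 0 T, translate (Pi.single 0 (2 * Real.pi / N)) (V t) = V t)
    (hclose : ∀ t ∈ Set.Icc 0 T, sobolevNorm s (V t - relaxingState (1 / ε ^ 2) a₁ a₂ t) ≤ 1)
    (hμ : 0 < μ) (hμ1 : μ ≤ 1)
    (hell : ∀ t ∈ Set.Icc 0 T', μ ≤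
      ((a₂ - a₁ + b * (a₁ + a₂)) * Real.exp (-(1 / ε ^ 2 * t)) - 1 / ε ^ 2) / 2)
    (hNγ : 1 / ε ^ 2 ≤ μ * N) :
    Real.exp (μ * N * T') * (d ^ 2 - 2 * (|1 - b ^ 2| * (2 * (1 + invSqSum)) * T' *
      Real.exp (1 / ε ^ 2 * T')) * invSqSum ^ 2 / (μ * N)) ≤ 4 := by
  have hN' : (0 : ℝ) < N := Nat.cast_pos.2 hN
  have hN1 : (1 : ℝ) ≤ N := Nat.one_le_cast.2 hN
  set γ := 1 / ε ^ 2 with hγ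
  have hγ0 : 0 < γ := by positivity
  set q := (N : ℝ) ^ (-s) with hq
  have hq0 : 0 < q := Real.rpow_pos_of_pos hN' _
  have hsub : ∀ t ∈ Set.Icc 0 T', t ∈ Set.Icc 0 T := fun t ht => ⟨ht.1, ht.2.trans hTT'⟩
  have hflow := (hV.shearFlow hinv).mono hTT'
  have hi1 : ∀ t ∈ Set.Icc 0 T, ∀ x (r : ℝ), (V t).1 (x + Pi.single 1 r) = (V t).1 x :=
    fun t ht x r => congrFun (congrArg Prod.fst (hinv t ht r)) x
  have hi2 : ∀ t ∈ Set.Icc 0 T, ∀ x (r : ℝ), (V t).2 (x + Pi.single 1 r) = (V t).2 x :=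
    fun t ht x r => congrFun (congrArg Prod.snd (hinv t ht r)) x
  have hsing : Continuous fun x : ℝ => (Pi.single 0 x : Point) :=
    (ContinuousLinearMap.single ℝ (fun _ : Fin 2 => ℝ) 0).continuous
  have hcoeff : ∀ {f : Point → ℝ}, Continuous f → (∀ x (r : ℝ), f (x + Pi.single 1 r) = f x) →
      sobolevSq s f ≤ 1 → ∀ k : ℤ,
        (1 + (k : ℝ) ^ 2) ^ s * ‖circleCoeff (fun x => f (Pi.single 0 x)) k‖ ^ 2 ≤ 1 := by
    intro f hf hfi hle k
    have h1 := weighted_sq_le_of_sobolevSq_le_one hle ![k, 0]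
    rw [show f = fun x => (fun r : ℝ => f (Pi.single 0 r)) (x 0) from
      funext (eq_comp_fst_of_invariant hfi),
      fourierCoefficient_comp_fst_eq_circleCoeff
        (g := fun r : ℝ => f (Pi.single 0 r)) (hf.comp hsing)] at h1
    simpa using h1
  have hb1 : ∀ t ∈ Set.Icc 0 T, ∀ k : ℤ, (1 + (k : ℝ) ^ 2) ^ s *
      ‖circleCoeff (fun x => (V t).1 (Pi.single 0 x) 1) k‖ ^ 2 ≤ 1 := by
    intro t ht
    refine hcoeff (f := fun x => (V t).1 x 1) ((hV.inPhaseSpace t ht).continuous_velocity 1)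
      (fun x r => by rw [hi1 t ht]) ?_
    simpa [relaxingState, diagState] using
      (sobolevSq_le_one_of_sobolevNorm_le_one (hclose t ht)).1 1
  have hb2 : ∀ t ∈ Set.Icc 0 T, ∀ k : ℤ, (1 + (k : ℝ) ^ 2) ^ s *
      ‖circleCoeff (fun x => (V t).2 (Pi.single 0 x) 1 0) k‖ ^ 2 ≤ 1 := by
    intro t ht
    refine hcoeff (f := fun x => (V t).2 x 1 0) ((hV.inPhaseSpace t ht).continuous_stress 1 0)
      (fun x r => by rw [hi2 t ht]) ?_
    simpa [relaxingState, diagState] using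
      (sobolevSq_le_one_of_sobolevNorm_le_one (hclose t ht)).2 1 0
  have hb3 : ∀ t ∈ Set.Icc 0 T, ∀ k : ℤ, (1 + (k : ℝ) ^ 2) ^ s *
      ‖circleCoeff (fun x => (V t).2 (Pi.single 0 x) 0 1) k‖ ^ 2 ≤ 1 := by
    intro t ht
    refine hcoeff (f := fun x => (V t).2 x 0 1) ((hV.inPhaseSpace t ht).continuous_stress 0 1)
      (fun x r => by rw [hi2 t ht]) ?_
    simpa [relaxingState, diagState] using
      (sobolevSq_le_one_of_sobolevNorm_le_one (hclose t ht)).2 0 1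
  have hperiodic : ∀ {f : Point → ℝ}, IsPeriodic f →
      Function.Periodic (fun x : ℝ => f (Pi.single 0 x)) (2 * Real.pi) := by
    intro f hf x
    simp only
    rw [Pi.single_add, hf]
  have hp1 : ∀ t ∈ Set.Icc 0 T, Function.Periodic (fun x : ℝ => (V t).1 (Pi.single 0 x) 1)
      (2 * Real.pi) := fun t ht => hperiodic ((hV.inPhaseSpace t ht).periodic_velocity 1)
  have hp2 : ∀ i j, ∀ t ∈ Set.Icc 0 T,
      Function.Periodic (fun x : ℝ => (V t).2 (Pi.single 0 x) i j) (2 * Real.pi) :=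
    fun i j t ht => hperiodic ((hV.inPhaseSpace t ht).periodic_stress i j)
  have hpN : ∀ t ∈ Set.Icc 0 T, Function.Periodic (fun x : ℝ => (V t).1 (Pi.single 0 x) 1)
      (2 * Real.pi / N) := by
    intro t ht x
    simp only
    rw [Pi.single_add]
    exact congrFun (congrFun (congrArg Prod.fst (hper t ht)) (Pi.single 0 x)) 1
  have hc1 : ∀ t ∈ Set.Icc 0 T, Continuous fun x : ℝ => (V t).1 (Pi.single 0 x) 1 :=
    fun t ht => ((hV.inPhaseSpace t ht).continuous_velocity 1).comp hsing
  have hc2 : ∀ i j, ∀ t ∈ Set.Icc 0 T, Continuous fun x : ℝ => (V t).2 (Pi.single 0 x) i j :=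
    fun i j t ht => ((hV.inPhaseSpace t ht).continuous_stress i j).comp hsing
  have hmode : ∀ {f : ℝ → ℝ}, (∀ k : ℤ, (1 + (k : ℝ) ^ 2) ^ s * ‖circleCoeff f k‖ ^ 2 ≤ 1) →
      ‖circleCoeff f N‖ ≤ q := by
    intro f hf
    refine norm_le_of_weighted_sq_le (by linarith) hN' ?_
    simpa using hf N
  -- The background has no velocity and no off-diagonal stress, so closeness to it bounds these
  -- components of V themselves. C adds the sup bounds of τ₁₂ and τ₂₁, G uses the period 2π/N, and B
  -- is the bound on mode N.
  have key := hflow.exp_growth hT' hγ0.le (A₀ := a₂ - a₁ + b * (a₁ + a₂))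
    (C := 2 * (1 + invSqSum)) (G := N * q * invSqSum) (B := 2 * Real.pi * q)
    (fun x => by simp [hV0, shearState])
    (fun t ht x => by
      have h1 := abs_le_of_weighted_sq_le (hc2 1 0 t (hsub t ht)) (hp2 1 0 t (hsub t ht)) hs
        (hb2 t (hsub t ht)) x
      have h2 := abs_le_of_weighted_sq_le (hc2 0 1 t (hsub t ht)) (hp2 0 1 t (hsub t ht)) hs
        (hb3 t (hsub t ht)) x
      refine (abs_add_le _ _).trans ?_
      linarith)
    (fun t ht x => abs_deriv_le_of_weighted_sq_le (contDiff_slice hflow.contDiff_velocity ht) hN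
      (hpN t (hsub t ht)) hs (hb1 t (hsub t ht)) x)
    (fun t ht => hp1 t (hsub t ht)) (fun t ht => hp2 1 0 t (hsub t ht)) hμ hμ1 hell hN hNγ
    (fun t ht => (abs_integral_mul_cos_sin_le (hc1 t (hsub t ht)) (hmode (hb1 t (hsub t ht)))).1)
    (fun t ht => (abs_integral_mul_cos_sin_le (hc2 1 0 t (hsub t ht))
      (hmode (hb2 t (hsub t ht)))).2)
  have ha0 : ∫ x in (0 : ℝ)..2 * Real.pi, (V 0).1 (Pi.single 0 x) 1 * Real.cos (N * x) =
      d * q * Real.pi := by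
    simp [hV0, shearState, trigField, trigProfile, mul_assoc, integral_cos_sq_nat hN]
  have hS0 : ∫ x in (0 : ℝ)..2 * Real.pi, (V 0).2 (Pi.single 0 x) 1 0 * Real.sin (N * x) =
      d * q * Real.pi := by
    simp [hV0, shearState, trigField, trigProfile, mul_assoc, integral_sin_sq_nat hN]
  rw [ha0, hS0] at key
  set D := |1 - b ^ 2| * (2 * (1 + invSqSum)) * T' * Real.exp (γ * T') with hD
  have hI := invSqSum_nonneg
  have hD0 : 0 ≤ D := by positivity
  -- The error is cubic in q and carries N² from G², whereas the initial product is quadratic in q.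
  -- The surplus N²q is at most 1, and the factor 1/(μN) remains to make the error small.
  have hNq : (N : ℝ) ^ 2 * q ≤ 1 := by
    have h1 : q ≤ (N : ℝ) ^ (-2 : ℝ) := Real.rpow_le_rpow_of_exponent_le hN1 (by linarith)
    have h2 : (N : ℝ) ^ (-2 : ℝ) = ((N : ℝ) ^ 2)⁻¹ := by
      rw [Real.rpow_neg hN'.le, Real.rpow_ofNat]
    calc (N : ℝ) ^ 2 * q ≤ (N : ℝ) ^ 2 * ((N : ℝ) ^ 2)⁻¹ := by rw [← h2]; gcongr
      _ = 1 := mul_inv_cancel₀ (by positivity)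
  have hlow : Real.pi ^ 2 * q ^ 2 * (d ^ 2 - 2 * D * invSqSum ^ 2 / (μ * N)) ≤
      d * q * Real.pi * (d * q * Real.pi) -
        Real.pi * D * (N * q * invSqSum) ^ 2 * (2 * Real.pi * q) / (μ * N) := by
    have e : Real.pi * D * (N * q * invSqSum) ^ 2 * (2 * Real.pi * q) / (μ * N) =
        Real.pi ^ 2 * q ^ 2 * (2 * D * invSqSum ^ 2 / (μ * N)) * ((N : ℝ) ^ 2 * q) := by ring
    have e2 : 0 ≤ Real.pi ^ 2 * q ^ 2 * (2 * D * invSqSum ^ 2 / (μ * N)) := by positivity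
    rw [e]
    nlinarith [mul_le_of_le_one_right e2 hNq]
  have h1 := (mul_le_mul_of_nonneg_left hlow (Real.exp_pos (μ * N * T')).le).trans key
  have hpq : 0 < Real.pi ^ 2 * q ^ 2 := by positivity
  -- Initial product and final bound both scale like q², which cancels; 4 is the ratio of (2πq)² to
  -- (πq)².
  refine le_of_mul_le_mul_left ?_ hpq
  calc _ = Real.exp (μ * N * T') *
        (Real.pi ^ 2 * q ^ 2 * (d ^ 2 - 2 * D * invSqSum ^ 2 / (μ * N))) := by ring
    _ ≤ (2 * Real.pi * q) ^ 2 := h1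
    _ = _ := by ring

/-- The hypothesis is A > γ at time 0, the ellipticity condition. Each clause of well-posedness is
used: existence for the perturbed solution, uniqueness for its symmetries, continuous dependence
with tolerance 1 for its H^s bound. -/
theorem not_wellPosedAt_diagState {b ε : ℝ} (hε : 0 < ε) (K : StressSpace) (C : TimeClass) {s : ℝ}
    (hs : 3 ≤ s) {a₁ a₂ : ℝ} (h : 1 / ε ^ 2 < a₂ - a₁ + b * (a₁ + a₂)) :
    ¬ WellPosedAt b ε K C s (diagState a₁ a₂) := by
  rintro ⟨T, hT, R, hR, hex, huniq, hcont⟩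
  have hs0 : 0 ≤ s := by linarith
  set γ := 1 / ε ^ 2 with hγ
  have hγ0 : 0 < γ := by positivity
  set A := a₂ - a₁ + b * (a₁ + a₂) with hA
  have hA0 : 0 < A := hγ0.trans h
  obtain ⟨δ, hδ, hdep⟩ := hcont 1 one_pos
  obtain ⟨d, hd, hdr⟩ := exists_small_amplitude s (lt_min hR hδ)
  set μ := min 1 ((A - γ) / 4) with hμ
  have hμ0 : 0 < μ := lt_min one_pos (by linarith)
  -- A relaxes, so ellipticity lasts for a limited time. By e^(-γt) ≥ 1 - γt at least half of A - γ
  -- survives up to T', whence the quarter in μ.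
  set T' := min T ((A - γ) / (2 * A * γ)) with hT'
  have hT'0 : 0 < T' := lt_min hT (div_pos (by linarith) (by positivity))
  have hell : ∀ t ∈ Set.Icc 0 T', μ ≤ (A * Real.exp (-(γ * t)) - γ) / 2 := by
    intro t ht
    have h1 : t ≤ (A - γ) / (2 * A * γ) := ht.2.trans (min_le_right _ _)
    rw [le_div_iff₀ (by positivity)] at h1
    have h2 := Real.add_one_le_exp (-(γ * t))
    have h3 : A * (-(γ * t) + 1) ≤ A * Real.exp (-(γ * t)) := by gcongr
    refine (min_le_right _ _).trans ?_
    linarith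
  set D := 2 * (|1 - b ^ 2| * (2 * (1 + invSqSum)) * T' * Real.exp (γ * T')) * invSqSum ^ 2
  -- The thresholds make μN exceed γ, the error at most d²/2, and μNT' · d²/2 exceed 4; the last one
  -- contradicts the growth bound through e^y ≥ y.
  obtain ⟨N, hN⟩ := exists_nat_gt (max (max 0 (γ / μ)) (max (2 * D / (μ * d ^ 2))
    (8 / (μ * T' * d ^ 2))))
  simp only [max_lt_iff] at hN
  obtain ⟨⟨hN0, hN1⟩, hN2, hN3⟩ := hN
  rw [div_lt_iff₀ (by positivity)] at hN1 hN2 hN3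
  have hNpos : 0 < N := Nat.cast_pos.1 hN0
  have hsmall : sobolevNorm s (shearState N a₁ a₂ (d * (N : ℝ) ^ (-s)) - diagState a₁ a₂) <
      min R δ := by
    rw [shearState_sub_diagState]
    exact (sobolevNorm_shearState_zero_le hNpos d hs0).trans_lt hdr
  have hphase := inPhaseSpace_shearState K hs0 hNpos a₁ a₂ (d * (N : ℝ) ^ (-s))
  obtain ⟨V, hV⟩ := hex _ hphase (hsmall.trans_le (min_le_left _ _))
  have hinv : ∀ h : Point, translate h (shearState N a₁ a₂ (d * (N : ℝ) ^ (-s))) =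
      shearState N a₁ a₂ (d * (N : ℝ) ^ (-s)) →
      ∀ t ∈ Set.Icc 0 T, translate h (V t) = V t := by
    intro h hh t ht
    have h1 := hV.translate h
    rw [hh] at h1
    exact huniq _ hphase (hsmall.trans_le (min_le_left _ _)) _ _ h1 hV t ht
  have hgrow := exp_growth_of_solution hε hs hT'0 (min_le_left _ _) hNpos hV.1 hV.2.2
    (fun t ht r => hinv _ (translate_shearState_single_one N a₁ a₂ _ r) t ht)
    (hinv _ (translate_shearState_single_zero hNpos a₁ a₂ _))
    (hdep _ hphase (hsmall.trans_le (min_le_right _ _)) _ _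
      (solvesFrom_relaxingState b ε K C hs0 hT a₁ a₂) hV)
    hμ0 (min_le_left _ _) hell (by linarith)
  have hD : D / (μ * N) ≤ d ^ 2 / 2 := by
    rw [div_le_iff₀ (by positivity)]
    linarith
  have h1 : μ * N * T' * (d ^ 2 / 2) ≤ Real.exp (μ * N * T') * (d ^ 2 - D / (μ * N)) := by
    have := Real.add_one_le_exp (μ * N * T')
    gcongr
    · linarith
    · linarith
  linarith

theorem not_wellPosedAt_isotropicState {b ε : ℝ} (hε : 0 < ε) (K : StressSpace) (C : TimeClass)
    {s : ℝ} (hs : 3 ≤ s) {a : ℝ} (h : 1 / (2 * ε ^ 2) < a * b) :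
    ¬ WellPosedAt b ε K C s (isotropicState a) := by
  rw [isotropicState_eq_diagState]
  refine not_wellPosedAt_diagState hε K C hs ?_
  have : 1 / ε ^ 2 = 2 * (1 / (2 * ε ^ 2)) := by field_simp
  linarith

theorem not_hadamardWellPosed {b ε : ℝ} (hε : 0 < ε) (K : StressSpace) (C : TimeClass)
    {s : ℝ} (hs : 3 ≤ s) : ¬ HadamardWellPosed b ε K C s := by
  intro h
  have hγ : 0 < 1 / ε ^ 2 := by positivity
  -- A trace-free stress removes b from A, which equals 2γ here.
  refine not_wellPosedAt_diagState hε K C hs (a₁ := -(1 / ε ^ 2)) (a₂ := 1 / ε ^ 2) ?_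
    (h _ (inPhaseSpace_diagState K (by linarith) _ _))
  linarith

/-! ### The linearized system -/

theorem contDiff_modeFactor (lam : ℝ) (k : ℤ) :
    ContDiff ℝ 1 fun z : ℝ × Point => modeFactor lam k z.1 z.2 := by
  unfold modeFactor
  have h1 : ContDiff ℝ 1 fun z : ℝ × Point => ((lam * z.1 : ℝ) : ℂ) :=
    Complex.ofRealCLM.contDiff.comp (contDiff_const.mul contDiff_fst)
  have h2 : ContDiff ℝ 1 fun z : ℝ × Point => ((z.2 0 : ℝ) : ℂ) :=
    Complex.ofRealCLM.contDiff.comp (by fun_prop)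
  exact h1.cexp.mul (contDiff_const.mul h2).cexp

theorem hasDerivAt_modeFactor (lam : ℝ) (k : ℤ) (t : ℝ) (x : Point) :
    HasDerivAt (fun r => modeFactor lam k r x) (lam * modeFactor lam k t x) t := by
  unfold modeFactor
  have h1 : HasDerivAt (fun r : ℝ => ((lam * r : ℝ) : ℂ)) ((lam * 1 : ℝ) : ℂ) t :=
    ((hasDerivAt_id t).const_mul lam).ofReal_comp
  refine (h1.cexp.mul_const _).congr_deriv ?_
  push_cast
  ring

theorem pderiv_modeFactor (lam : ℝ) (k : ℤ) (t : ℝ) (x : Point) (j : Fin 2) (c : ℂ) :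
    pderiv j (fun y => modeFactor lam k t y * c) x =
      if j = 0 then Complex.I * k * modeFactor lam k t x * c else 0 := by
  fin_cases j
  · have h1 : HasDerivAt (fun r : ℝ => Complex.I * (k : ℂ) * (r : ℂ)) (Complex.I * k * 1) (x 0) :=
      (Complex.ofRealCLM.hasDerivAt (x := x 0)).const_mul _
    have h2 : HasDerivAt (fun r : ℝ => Complex.exp ((lam * t : ℝ) : ℂ) *
        Complex.exp (Complex.I * (k : ℂ) * (r : ℂ)) * c)
        (Complex.I * k * modeFactor lam k t x * c) (x 0) := by
      refine ((h1.cexp.const_mul _).mul_const c).congr_deriv ?_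
      unfold modeFactor
      ring
    exact (pderiv_zero_comp_fst h2.differentiableAt).trans h2.deriv
  · exact pderiv_eq_zero_of_invariant (fun x r => by simp [modeFactor]) x

theorem lambdaPlus_mul {b ε a : ℝ} (h : 1 / (2 * ε ^ 2) < a * b) (k : ℤ) :
    lambdaPlus b ε a k * (lambdaPlus b ε a k + 1 / ε ^ 2) =
      (a * b - 1 / (2 * ε ^ 2)) * (k : ℝ) ^ 2 := by
  have hd : 0 ≤ (1 / ε ^ 2) ^ 2 + 4 * (a * b - 1 / (2 * ε ^ 2)) * (k : ℝ) ^ 2 := by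
    have : 0 ≤ a * b - 1 / (2 * ε ^ 2) := by linarith
    positivity
  have hsq := Real.mul_self_sqrt hd
  unfold lambdaPlus
  linarith

/-- For isotropic stress Q(τ_a, ∇u) = 2ab D(u), so only the off-diagonal entry σ of the mode is
excited, and no pressure. The source -γτ_a is absorbed by the relaxing isotropic part of η. -/
theorem solvesLinearized_lambdaPlus {b ε a : ℝ} (h : 1 / (2 * ε ^ 2) < a * b) {k : ℤ}
    (hk : k ≠ 0) : ∃ (P : ℂ) (S : Matrix (Fin 2) (Fin 2) ℂ), SolvesLinearized b ε a
      (fun t x => ![0, modeFactor (lambdaPlus b ε a k) k t x])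
      (fun t x => P * modeFactor (lambdaPlus b ε a k) k t x)
      (fun t x => (a * (Real.exp (-t / ε ^ 2) - 1)) • (1 : Matrix (Fin 2) (Fin 2) ℂ) +
        modeFactor (lambdaPlus b ε a k) k t x • S) := by
  have hkc : (k : ℂ) ≠ 0 := Int.cast_ne_zero.2 hk
  have hlam := lambdaPlus_mul h k
  set l := lambdaPlus b ε a k with hl
  have hlc : (l : ℂ) * (l + ((1 / ε ^ 2 : ℝ) : ℂ)) =
      (a * b - ((1 / ε ^ 2 : ℝ) : ℂ) / 2) * (k : ℂ) ^ 2 := by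
    have h1 : l * (l + 1 / ε ^ 2) = (a * b - (1 / ε ^ 2) / 2) * (k : ℝ) ^ 2 := by
      rw [hlam]; ring
    exact_mod_cast congrArg (fun r : ℝ => (r : ℂ)) h1
  set γ : ℝ := 1 / ε ^ 2 with hγ
  have hexp : ∀ t, Real.exp (-t / ε ^ 2) = Real.exp (-(γ * t)) := fun t => by
    rw [hγ]; congr 1; ring
  -- Dictated by the momentum equation λ = ikσ; the stress equation then becomes the dispersion
  -- relation.
  set σ : ℂ := -(Complex.I * l / k) with hσ
  have hσk : Complex.I * k * σ = l := by
    rw [hσ]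
    field_simp
    rw [Complex.I_sq]
    ring
  have hσl : σ * (l + (γ : ℂ)) = Complex.I * k * ((γ : ℂ) / 2 - a * b) := by
    have : σ * (l + (γ : ℂ)) = -(Complex.I / k * (l * (l + (γ : ℂ)))) := by
      rw [hσ]; ring
    rw [this, hlc]
    field_simp
    ring
  have hm : ∀ t : ℝ, ∀ x, HasDerivAt (fun r => modeFactor l k r x) (l * modeFactor l k t x) t :=
    hasDerivAt_modeFactor l k
  have hrel : ∀ t : ℝ, HasDerivAt (fun r : ℝ => ((a * (Real.exp (-r / ε ^ 2) - 1) : ℝ) : ℂ))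
      ((-(γ * (a * Real.exp (-t / ε ^ 2))) : ℝ) : ℂ) t := by
    intro t
    simp_rw [hexp]
    have h1 : HasDerivAt (fun r => a * (Real.exp (-(γ * r)) - 1))
        (a * (Real.exp (-(γ * t)) * (-(γ * 1)))) t :=
      ((((hasDerivAt_id t).const_mul γ).neg.exp).sub_const 1).const_mul a
    refine (h1.congr_deriv ?_).ofReal_comp
    ring
  have hp : ∀ (t : ℝ) x (j : Fin 2) (c d : ℂ), pderiv j (fun y => d + modeFactor l k t y * c) x =
      if j = 0 then Complex.I * k * modeFactor l k t x * c else 0 := by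
    intro t x j c d
    rw [← pderiv_modeFactor]
    unfold pderiv
    rw [fderiv_const_add]
  have hη : ∀ (t : ℝ) (x : Point) (i j : Fin 2),
      ((a * (Real.exp (-t / ε ^ 2) - 1)) • (1 : Matrix (Fin 2) (Fin 2) ℂ) +
        modeFactor l k t x • !![0, σ; σ, 0]) i j =
      ((a * (Real.exp (-t / ε ^ 2) - 1) : ℝ) : ℂ) * (1 : Matrix (Fin 2) (Fin 2) ℂ) i j +
        modeFactor l k t x * (!![0, σ; σ, 0] : Matrix (Fin 2) (Fin 2) ℂ) i j := by
    intro t x i j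
    rw [Matrix.add_apply, Matrix.smul_apply, Matrix.smul_apply, Complex.real_smul, smul_eq_mul]
  have hgrad : ∀ t x, grad (fun x => ![0, modeFactor l k t x]) x =
      !![0, 0; Complex.I * k * modeFactor l k t x, 0] := by
    intro t x
    have h1 : ∀ j, pderiv j (fun y => modeFactor l k t y) x =
        if j = 0 then Complex.I * k * modeFactor l k t x else 0 := fun j => by
      simpa using pderiv_modeFactor l k t x j 1
    ext i j
    fin_cases i <;> fin_cases j <;> simp [grad, pderiv_const, h1]
  refine ⟨0, !![0, σ; σ, 0], ?_, ?_, ?_, ?_, ?_, ?_⟩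
  · intro i
    fin_cases i
    · exact contDiff_const
    · exact contDiff_modeFactor l k
  · intro t
    simp only [zero_mul]
    exact contDiff_const
  · intro i j
    simp only [hη]
    have h0 : ContDiff ℝ 1 fun z : ℝ × Point => a * (Real.exp (-z.1 / ε ^ 2) - 1) := by fun_prop
    have h1 : ContDiff ℝ 1 fun z : ℝ × Point => ((a * (Real.exp (-z.1 / ε ^ 2) - 1) : ℝ) : ℂ) :=
      Complex.ofRealCLM.contDiff.comp h0
    exact (h1.mul contDiff_const).add ((contDiff_modeFactor l k).mul contDiff_const)
  · intro t x i
    simp only [zero_mul, pderiv_const, add_zero, divTensor, hη, hp]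
    fin_cases i
    · simp
    · simp only [Fin.mk_one, Matrix.cons_val_one, Matrix.cons_val_fin_one, (hm t x).deriv]
      simp
      rw [mul_right_comm, hσk]
  · intro t x i j
    simp only [hη, hgrad]
    rw [(((hrel t).mul_const _).fun_add ((hm t x).mul_const _)).deriv]
    have hγc : ((ε : ℂ) ^ 2)⁻¹ = γ := by rw [hγ]; push_cast; ring
    fin_cases i <;> fin_cases j <;> simp [rotationQ, symPart, skewPart] <;> rw [hγc]
    · ring
    · linear_combination modeFactor l k t x * hσl
    · linear_combination modeFactor l k t x * hσl
    · ring
  · intro t x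
    have h1 := pderiv_modeFactor l k t x 1 1
    simp only [mul_one] at h1
    simp [divVec, Fin.sum_univ_two, pderiv_const, h1]

theorem tendsto_lambdaPlus_div (b ε a : ℝ) :
    Filter.Tendsto (fun k : ℤ => lambdaPlus b ε a k / |(k : ℝ)|) Filter.cofinite
      (nhds (Real.sqrt (a * b - 1 / (2 * ε ^ 2)))) := by
  set c := a * b - 1 / (2 * ε ^ 2) with hc
  have hk : Filter.Tendsto (fun k : ℤ => |(k : ℝ)|⁻¹) Filter.cofinite (nhds 0) := by
    refine tendsto_inv_atTop_zero.comp ?_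
    have := tendsto_norm_cocompact_atTop.comp Int.tendsto_coe_cofinite
    simpa [Function.comp_def] using this
  have hlim : Filter.Tendsto (fun k : ℤ => (-(1 / ε ^ 2) * |(k : ℝ)|⁻¹ +
      Real.sqrt ((1 / ε ^ 2 * |(k : ℝ)|⁻¹) ^ 2 + 4 * c)) / 2) Filter.cofinite
      (nhds ((-(1 / ε ^ 2) * 0 + Real.sqrt ((1 / ε ^ 2 * 0) ^ 2 + 4 * c)) / 2)) :=
    ((hk.const_mul _).add ((((hk.const_mul _).pow 2).add_const _).sqrt)).div_const 2
  have hval : (-(1 / ε ^ 2) * 0 + Real.sqrt ((1 / ε ^ 2 * 0) ^ 2 + 4 * c)) / 2 = Real.sqrt c := by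
    rw [show (1 / ε ^ 2 * 0) ^ 2 + 4 * c = 2 ^ 2 * c by ring, Real.sqrt_mul (by norm_num),
      Real.sqrt_sq (by norm_num)]
    ring
  rw [hval] at hlim
  refine hlim.congr' ?_
  filter_upwards [(Set.finite_singleton (0 : ℤ)).compl_mem_cofinite] with k hk0
  have hk1 : (k : ℝ) ≠ 0 := Int.cast_ne_zero.2 hk0
  have hk2 : 0 < |(k : ℝ)| := abs_pos.2 hk1
  unfold lambdaPlus
  -- Pulling |k| out of the square root leaves a continuous function of 1/|k|.
  rw [← hc, show (1 / ε ^ 2) ^ 2 + 4 * c * (k : ℝ) ^ 2 =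
    |(k : ℝ)| ^ 2 * ((1 / ε ^ 2 * |(k : ℝ)|⁻¹) ^ 2 + 4 * c) by
      rw [mul_add, mul_pow, ← sq_abs (k : ℝ)]; field_simp,
    Real.sqrt_mul (by positivity), Real.sqrt_sq hk2.le]
  field_simp

end EulerOldroydB

theorem theorem1p1 (b ε : ℝ) (hε : 0 < ε) :
    -- nonlinear ill-posedness
    (∀ (s : ℝ), 3 ≤ s → ∀ (K : EulerOldroydB.StressSpace) (C : EulerOldroydB.TimeClass),
      ¬ EulerOldroydB.HadamardWellPosed b ε K C s) ∧
    -- instability of the isotropic stress states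
    (∀ a : ℝ, 1 / (2 * ε ^ 2) < a * b →
      (∀ (s : ℝ), 3 ≤ s → ∀ (K : EulerOldroydB.StressSpace) (C : EulerOldroydB.TimeClass),
        ¬ EulerOldroydB.WellPosedAt b ε K C s (EulerOldroydB.isotropicState a)) ∧
      (∀ k : ℤ, k ≠ 0 → ∃ (P : ℂ) (S : Matrix (Fin 2) (Fin 2) ℂ),
        EulerOldroydB.SolvesLinearized b ε a
          (fun t x => ![0, EulerOldroydB.modeFactor (EulerOldroydB.lambdaPlus b ε a k) k t x])
          (fun t x => P * EulerOldroydB.modeFactor (EulerOldroydB.lambdaPlus b ε a k) k t x)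
          (fun t x => (a * (Real.exp (-t / ε ^ 2) - 1)) • (1 : Matrix (Fin 2) (Fin 2) ℂ) +
            EulerOldroydB.modeFactor (EulerOldroydB.lambdaPlus b ε a k) k t x • S)) ∧
      0 < Real.sqrt (a * b - 1 / (2 * ε ^ 2)) ∧
      Filter.Tendsto (fun k : ℤ => EulerOldroydB.lambdaPlus b ε a k / |(k : ℝ)|) Filter.cofinite
        (nhds (Real.sqrt (a * b - 1 / (2 * ε ^ 2))))) := by
  refine ⟨fun s hs K C => EulerOldroydB.not_hadamardWellPosed hε K C hs, fun a ha =>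
    ⟨fun s hs K C => EulerOldroydB.not_wellPosedAt_isotropicState hε K C hs ha,
      fun k hk => EulerOldroydB.solvesLinearized_lambdaPlus ha hk,
      Real.sqrt_pos.2 (sub_pos.2 ha), EulerOldroydB.tendsto_lambdaPlus_div b ε a⟩⟩
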